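/- **Universal Coefficient Theorem for Cohomology of Projective Complexes.** Let $\mathcal A$ be the category of left modules over an associative ring with identity or, more generally, an abelian category with enough injectives. For an object $B$ of $\mathcal A$ choose an injective resolution $0\to B\to I^0\to I^1\to\cdots$ and put $\Sigma^iB=\operatorname{Ker}(I^i\to I^{i+1})$ (so $\Sigma^0B\cong B$ and $\Sigma^{i+1}B=\operatorname{Coker}(\Sigma^iB\to I^i)$). For an additive functor $F:\mathcal A\to\mathbf{Ab}$ let $R^iF$ ($i\ge 0$) be its right derived functors, $R^iF(B)=H^i(F(I^\bullet))$, let $\rho_F:F\to R^0F$ be the canonical transformation, let $\overline F=\operatorname{Ker}\rho_F$ be the sub-stabilization of $F$ (so $\overline F(B)=\operatorname{Ker}(F(B)\to F(J))$ for any embedding of $B$ in an injective object $J$), and for $i\ge 1$ let $S^iF$ be the $i$-th right satellite, $S^iF(B)=\operatorname{Coker}(F(I^{i-1})\to F(\Sigma^iB))$. The right fundamental sequence of $F$ is the sequence of functors $$0\to\overline F\to F\xrightarrow{\rho_F}R^0F\to\overline F\circ\Sigma\to S^1F\to R^1F\to\overline F\circ\Sigma^2\to S^2F\to R^2F\to\cdots$$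 in which, for $i\ge1$, $\overline F(\Sigma^iB)\to S^iF(B)$ is the composite $\overline F(\Sigma^iB)\hookrightarrow F(\Sigma^iB)\twoheadrightarrow S^iF(B)$, the map $S^iF(B)\to R^iF(B)$ is induced by $F(\Sigma^iB)\to\operatorname{Ker}(F(I^i)\to F(I^{i+1}))$, and, for $i\ge0$, $R^iF(B)\to\overline F(\Sigma^{i+1}B)$ is induced by $F(I^i)\to F(\Sigma^{i+1}B)$. Let $\mathbf C:\ \cdots\to C_{n+1}\to C_n\to C_{n-1}\to\cdots$ be a complex of projective objects of $\mathcal A$, indexed by $\mathbb Z$, let $B_i\subseteq C_i$ denote the boundaries and $H_i(\mathbf C)$ the homology, let $(X,-)=\operatorname{Hom}(X,-)$, and let $H^n(\mathbf C,-)$ be the $n$-th cohomology of the complex $\operatorname{Hom}(\mathbf C,-)$. Then for every integer $n$ the right fundamental sequence of the functor $H^n(\mathbf C,-)$ is exact, and it is isomorphic, by isomorphisms natural in the argument, to an exact sequence of functors of the form $$0\to\operatorname{Ext}^1(C_{n-1}/B_{n-1},-)\to H^n(\mathbf C,-)\to(H_n(\mathbf C),-)\to\operatorname{Ext}^2(C_{n-1}/B_{n-1},-)\to\operatorname{Ext}^1(C_n/B_n,-)\to\operatorname{Ext}^1(H_n(\mathbf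 C),-)\to\operatorname{Ext}^3(C_{n-1}/B_{n-1},-)\to\operatorname{Ext}^2(C_n/B_n,-)\to\operatorname{Ext}^2(H_n(\mathbf C),-)\to\cdots$$ with the isomorphism on the term $H^n(\mathbf C,-)$ being the identity and with $H^n(\mathbf C,-)\to(H_n(\mathbf C),-)$ being the canonical map, which sends the class of a cocycle $C_n\to M$ to the induced map $H_n(\mathbf C)\to M$. In particular, with $F=H^n(\mathbf C,-)$, there are natural isomorphisms $\overline F\cong\operatorname{Ext}^1(C_{n-1}/B_{n-1},-)$, $\overline F\circ\Sigma^i\cong\operatorname{Ext}^{i+1}(C_{n-1}/B_{n-1},-)$ and $S^iF\cong\operatorname{Ext}^i(C_n/B_n,-)$ for $i\ge1$, and $R^0F\cong(H_n(\mathbf C),-)$, $R^iF\cong\operatorname{Ext}^i(H_n(\mathbf C),-)$ for $i\ge1$. -/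

import Mathlib

universe w v u

open CategoryTheory CategoryTheory.Limits

noncomputable section

namespace FundSeq

variable {A : Type u} [Category.{v} A] [Abelian A]

/-! ### Long sequences of functors -/

/-- A sequence of functors and natural transformations
`X 0 ⟶ Y 0 ⟶ Z 0 ⟶ X 1 ⟶ Y 1 ⟶ Z 1 ⟶ X 2 ⟶ ⋯`. -/
structure LongSeq (A : Type u) [Category.{v} A] where
  X : ℕ → A ⥤ AddCommGrpCat.{w}
  Y : ℕ → A ⥤ AddCommGrpCat.{w}
  Z : ℕ → A ⥤ AddCommGrpCat.{w}
  f (i : ℕ) : X i ⟶ Y i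
  g (i : ℕ) : Y i ⟶ Z i
  h (i : ℕ) : Z i ⟶ X (i + 1)

/-- Exactness of `0 ⟶ X 0 ⟶ Y 0 ⟶ Z 0 ⟶ X 1 ⟶ ⋯` as a sequence of functors, that is, of all its
evaluations at objects. -/
structure LongSeq.IsExact (S : LongSeq.{w} A) : Prop where
  injective (B : A) : Function.Injective ((S.f 0).app B)
  exact_Y (i : ℕ) (B : A) : Function.Exact ((S.f i).app B) ((S.g i).app B)
  exact_Z (i : ℕ) (B : A) : Function.Exact ((S.g i).app B) ((S.h i).app B)
  exact_X (i : ℕ) (B : A) : Function.Exact ((S.h i).app B) ((S.f (i + 1)).app B)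

/-- An isomorphism of sequences of functors: natural isomorphisms between the terms that commute
with all the maps of the sequences. -/
structure LongSeq.Iso (S T : LongSeq.{w} A) where
  isoX (i : ℕ) : S.X i ≅ T.X i
  isoY (i : ℕ) : S.Y i ≅ T.Y i
  isoZ (i : ℕ) : S.Z i ≅ T.Z i
  comm_f (i : ℕ) : S.f i ≫ (isoY i).hom = (isoX i).hom ≫ T.f i
  comm_g (i : ℕ) : S.g i ≫ (isoZ i).hom = (isoY i).hom ≫ T.g i
  comm_h (i : ℕ) : S.h i ≫ (isoX (i + 1)).hom = (isoZ i).hom ≫ T.h i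

/-! ### Cosyzygies -/

section Cosyzygy

lemma d_comp_toCycles (K : CochainComplex A ℕ) (l i : ℕ) :
    K.d l i ≫ K.toCycles i (i + 1) = 0 := by
  rw [← cancel_mono (K.iCycles (i + 1))]
  simp

lemma cyclesMap_eq_of_homotopy {K L : CochainComplex A ℕ} {φ ψ : K ⟶ L} (h : Homotopy φ ψ)
    (k : ℕ) :
    HomologicalComplex.cyclesMap φ (k + 1) = HomologicalComplex.cyclesMap ψ (k + 1) +
      K.iCycles (k + 1) ≫ h.hom (k + 1) k ≫ L.toCycles k (k + 1) := by
  rw [← cancel_mono (L.iCycles (k + 1))]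
  simp only [HomologicalComplex.cyclesMap_i, Preadditive.add_comp, Category.assoc,
    HomologicalComplex.toCycles_i]
  rw [h.comm (k + 1), dNext_eq h.hom (show (ComplexShape.up ℕ).Rel (k + 1) (k + 2) from rfl),
    prevD_eq h.hom (show (ComplexShape.up ℕ).Rel k (k + 1) from rfl)]
  simp [Preadditive.comp_add, add_comm]

variable [EnoughInjectives A]

/-- The chosen injective resolution `I⁰ ⟶ I¹ ⟶ ⋯` of an object. -/
abbrev res (B : A) : CochainComplex A ℕ := (injectiveResolution B).cocomplex

/-- A lift of a morphism to the chosen injective resolutions. -/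
abbrev resMap {B B' : A} (f : B ⟶ B') : res B ⟶ res B' :=
  InjectiveResolution.desc f (injectiveResolution B') (injectiveResolution B)

/-- The cosyzygy object `Σⁱ B = Ker (Iⁱ ⟶ Iⁱ⁺¹)`; for `i = k + 1` it is also the cokernel of
`Σᵏ B ⟶ Iᵏ`, the projection being `(res B).toCycles k (k + 1)`. -/
abbrev cosyzygy (B : A) (i : ℕ) : A := (res B).cycles i

/-- The map on cosyzygy objects induced by a lift of a morphism to the resolutions. -/
abbrev cosyzygyMap {B B' : A} (f : B ⟶ B') (i : ℕ) : cosyzygy B i ⟶ cosyzygy B' i :=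
  HomologicalComplex.cyclesMap (resMap f) i

lemma cosyzygyMap_id (B : A) (k : ℕ) :
    ∃ t : (res B).X (k + 1) ⟶ (res B).X k, cosyzygyMap (𝟙 B) (k + 1) = 𝟙 _ +
      (res B).iCycles (k + 1) ≫ t ≫ (res B).toCycles k (k + 1) :=
  ⟨_, by
    simpa using cyclesMap_eq_of_homotopy
      (InjectiveResolution.descIdHomotopy B (injectiveResolution B)) k⟩

lemma cosyzygyMap_comp {B B' B'' : A} (f : B ⟶ B') (g : B' ⟶ B'') (k : ℕ) :
    ∃ t : (res B).X (k + 1) ⟶ (res B'').X k,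
      cosyzygyMap (f ≫ g) (k + 1) = cosyzygyMap f (k + 1) ≫ cosyzygyMap g (k + 1) +
        (res B).iCycles (k + 1) ≫ t ≫ (res B'').toCycles k (k + 1) :=
  ⟨_, (cyclesMap_eq_of_homotopy (InjectiveResolution.descCompHomotopy f g
      (injectiveResolution B) (injectiveResolution B') (injectiveResolution B'')) k).trans
    (congrArg (· + _) (HomologicalComplex.cyclesMap_comp _ _ _))⟩

lemma toCycles_naturality (F : A ⥤ AddCommGrpCat.{w}) {B B' : A} (f : B ⟶ B') (k : ℕ) :
    F.map ((resMap f).f k) ≫ F.map ((res B').toCycles k (k + 1)) =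
      F.map ((res B).toCycles k (k + 1)) ≫ F.map (cosyzygyMap f (k + 1)) := by
  rw [← F.map_comp, ← F.map_comp]
  congr 1
  rw [← cancel_mono (HomologicalComplex.iCycles _ _)]
  simp

end Cosyzygy

/-! ### Sub-stabilization, satellites and the fundamental sequence of an additive functor -/

section Functors

variable [EnoughInjectives A] (F : A ⥤ AddCommGrpCat.{w}) [F.Additive]

/-- The sub-stabilization of `F`: the kernel of the canonical transformation `F ⟶ R⁰F`. -/
def subStab : A ⥤ AddCommGrpCat.{w} := kernel F.toRightDerivedZero

/-- The inclusion of the sub-stabilization. -/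
def subStabι : subStab F ⟶ F := kernel.ι F.toRightDerivedZero

lemma subStabι_comp : subStabι F ≫ F.toRightDerivedZero = 0 := kernel.condition _

lemma subStabι_comp_app (B : A) :
    (subStabι F).app B ≫ F.toRightDerivedZero.app B = 0 := by
  rw [← NatTrans.comp_app, subStabι_comp]; rfl

lemma subStabι_app_comp_map {X J : A} [Injective J] (j : X ⟶ J) :
    (subStabι F).app X ≫ F.map j = 0 := by
  rw [← cancel_mono (F.toRightDerivedZero.app J), Category.assoc,
    F.toRightDerivedZero.naturality, ← Category.assoc, subStabι_comp_app, zero_comp, zero_comp]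

instance : Mono (subStabι F) := inferInstanceAs (Mono (kernel.ι F.toRightDerivedZero))

instance (B : A) : Mono ((subStabι F).app B) := inferInstance

/-- The kernel property of the sub-stabilization at an object. -/
def subStabAppIsLimit (B : A) :
    IsLimit (KernelFork.ofι ((subStabι F).app B) (subStabι_comp_app F B)) :=
  (KernelFork.isLimitMapConeEquiv (KernelFork.ofι (subStabι F) (subStabι_comp F))
      ((evaluation A AddCommGrpCat.{w}).obj B))
    (isLimitOfPreserves ((evaluation A AddCommGrpCat.{w}).obj B)
      (c := KernelFork.ofι (subStabι F) (subStabι_comp F))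
      (kernelIsKernel F.toRightDerivedZero))

lemma comp_toRightDerivedZero_eq_zero {G : AddCommGrpCat.{w}} {B : A} (x : G ⟶ F.obj B)
    {J : A} (j : B ⟶ J) [Mono j] [Injective J] (hx : x ≫ F.map j = 0) :
    x ≫ F.toRightDerivedZero.app B = 0 := by
  let I := injectiveResolution B
  have h (a : B ⟶ I.cocomplex.X 0) : x ≫ F.map a = 0 := by
    rw [← Injective.comp_factorThru a j, F.map_comp, ← Category.assoc, hx, zero_comp]
  have h' : x ≫ I.toRightDerivedZero' F = 0 := by
    rw [← cancel_mono (HomologicalComplex.iCycles _ _), Category.assoc, zero_comp]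
    exact (congrArg (x ≫ ·) (I.toRightDerivedZero'_comp_iCycles F)).trans (h _)
  rw [I.toRightDerivedZero_eq F, ← Category.assoc, h', zero_comp]

/-- The sub-stabilization at `B` is the kernel of `F(B) ⟶ F(J)` for every embedding of `B` in an
injective object `J`. -/
def subStabLift {G : AddCommGrpCat.{w}} {B : A} (x : G ⟶ F.obj B)
    {J : A} (j : B ⟶ J) [Mono j] [Injective J] (hx : x ≫ F.map j = 0) :
    G ⟶ (subStab F).obj B :=
  (KernelFork.IsLimit.lift' (subStabAppIsLimit F B) x
    (comp_toRightDerivedZero_eq_zero F x j hx)).1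

@[simp]
lemma subStabLift_ι {G : AddCommGrpCat.{w}} {B : A} (x : G ⟶ F.obj B)
    {J : A} (j : B ⟶ J) [Mono j] [Injective J] (hx : x ≫ F.map j = 0) :
    subStabLift F x j hx ≫ (subStabι F).app B = x :=
  (KernelFork.IsLimit.lift' (subStabAppIsLimit F B) x
    (comp_toRightDerivedZero_eq_zero F x j hx)).2

@[simp]
lemma subStabLift_ι_assoc {G H : AddCommGrpCat.{w}} {B : A} (x : G ⟶ F.obj B)
    {J : A} (j : B ⟶ J) [Mono j] [Injective J] (hx : x ≫ F.map j = 0) (y : F.obj B ⟶ H) :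
    subStabLift F x j hx ≫ (subStabι F).app B ≫ y = x ≫ y := by
  rw [← Category.assoc, subStabLift_ι]

lemma subStab_map_add_eq {X Y J : A} [Injective J] (a b : X ⟶ Y) (s : X ⟶ J) (t : J ⟶ Y)
    (e : a = b + s ≫ t) : (subStab F).map a = (subStab F).map b := by
  rw [← cancel_mono ((subStabι F).app Y), (subStabι F).naturality, (subStabι F).naturality, e,
    F.map_add, Preadditive.comp_add, F.map_comp, ← Category.assoc _ (F.map s),
    subStabι_app_comp_map F s, zero_comp, add_zero]

/-- The functor `F̄ ∘ Σᵏ⁺¹`, where `F̄` is the sub-stabilization of `F`. -/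
def subStabCosyzygy (k : ℕ) : A ⥤ AddCommGrpCat.{w} where
  obj B := (subStab F).obj (cosyzygy B (k + 1))
  map f := (subStab F).map (cosyzygyMap f (k + 1))
  map_id B := by
    obtain ⟨t, ht⟩ := cosyzygyMap_id B k
    exact (subStab_map_add_eq F _ _ _ _ ht).trans ((subStab F).map_id _)
  map_comp f g := by
    obtain ⟨t, ht⟩ := cosyzygyMap_comp f g k
    exact (subStab_map_add_eq F _ _ _ _ ht).trans ((subStab F).map_comp _ _)

/-- The value at `B` of the satellite `Sᵏ⁺¹F`: the cokernel of `F(Iᵏ) ⟶ F(Σᵏ⁺¹ B)`. -/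
abbrev satelliteObj (B : A) (k : ℕ) : AddCommGrpCat.{w} :=
  cokernel (F.map ((res B).toCycles k (k + 1)))

/-- The map `Sᵏ⁺¹F(B) ⟶ Sᵏ⁺¹F(B')` induced by a morphism `B ⟶ B'`. -/
def satelliteMap {B B' : A} (f : B ⟶ B') (k : ℕ) : satelliteObj F B k ⟶ satelliteObj F B' k :=
  cokernel.map _ _ (F.map ((resMap f).f k)) (F.map (cosyzygyMap f (k + 1)))
    (toCycles_naturality F f k).symm

lemma map_add_comp_cokernelπ {X B : A} {k : ℕ} (a b : X ⟶ cosyzygy B (k + 1))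
    (s : X ⟶ (res B).X k) (e : a = b + s ≫ (res B).toCycles k (k + 1)) :
    F.map a ≫ cokernel.π (F.map ((res B).toCycles k (k + 1))) =
      F.map b ≫ cokernel.π (F.map ((res B).toCycles k (k + 1))) := by
  rw [e, F.map_add, Preadditive.add_comp, F.map_comp, Category.assoc, cokernel.condition,
    comp_zero, add_zero]

/-- The right satellite `Sᵏ⁺¹F`. -/
def satellite (k : ℕ) : A ⥤ AddCommGrpCat.{w} where
  obj B := satelliteObj F B k
  map f := satelliteMap F f k
  map_id B := by
    obtain ⟨t, ht⟩ := cosyzygyMap_id B k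
    rw [← cancel_epi (cokernel.π _), satelliteMap, cokernel.π_desc,
      map_add_comp_cokernelπ F _ _ ((res B).iCycles (k + 1) ≫ t) (by simpa using ht)]
    simp
  map_comp {B B' B''} f g := by
    obtain ⟨t, ht⟩ := cosyzygyMap_comp f g k
    rw [← cancel_epi (cokernel.π _), satelliteMap, cokernel.π_desc,
      map_add_comp_cokernelπ F _ _ ((res B).iCycles (k + 1) ≫ t) (by simpa using ht)]
    simp [satelliteMap]

/-- `F̄ ∘ Σᵏ⁺¹ ⟶ Sᵏ⁺¹F`, the composite `F̄(Σᵏ⁺¹ B) ⟶ F(Σᵏ⁺¹ B) ⟶ Sᵏ⁺¹F(B)`. -/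
def subStabToSatellite (k : ℕ) : subStabCosyzygy F k ⟶ satellite F k where
  app B := (subStabι F).app (cosyzygy B (k + 1)) ≫ cokernel.π _
  naturality B B' f := by
    simp [subStabCosyzygy, satellite, satelliteMap]

lemma square_comp {X₁ X₂ X₃ Y₁ Y₂ Y₃ : AddCommGrpCat.{w}} {a : X₁ ⟶ X₂} {b : X₂ ⟶ X₃}
    {a' : Y₁ ⟶ Y₂} {b' : Y₂ ⟶ Y₃} {m₁ : X₁ ⟶ Y₁} {m₂ : X₂ ⟶ Y₂} {m₃ : X₃ ⟶ Y₃}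
    (h₁ : m₁ ≫ a' = a ≫ m₂) (h₂ : m₂ ≫ b' = b ≫ m₃) : m₁ ≫ a' ≫ b' = (a ≫ b) ≫ m₃ := by
  rw [Category.assoc, ← h₂, ← Category.assoc, ← Category.assoc, h₁]

/-- Given a complex `K` and a factorization `K.X k ⟶ Q ⟶ K.X (k + 1)` of its differential with
`Q ⟶ K.X (k + 1) ⟶ K.X (k + 2)` zero, the map from the cokernel of `K.X k ⟶ Q` to the homology
induced by `Q ⟶ Ker (K.X (k + 1) ⟶ K.X (k + 2))`. -/
def cokernelToHomology (K : CochainComplex AddCommGrpCat.{w} ℕ) (k : ℕ) {Q : AddCommGrpCat.{w}}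
    (p : K.X k ⟶ Q) (a : Q ⟶ K.X (k + 1)) (e : p ≫ a = K.d k (k + 1))
    (z : a ≫ K.d (k + 1) (k + 2) = 0) : cokernel p ⟶ K.homology (k + 1) :=
  cokernel.desc p (K.liftCycles a (k + 2) (by simp) z ≫ K.homologyπ (k + 1)) (by
    have : p ≫ K.liftCycles a (k + 2) (by simp) z = K.toCycles k (k + 1) := by
      rw [← cancel_mono (K.iCycles (k + 1))]
      simp [e]
    rw [← Category.assoc, this, HomologicalComplex.toCycles_comp_homologyπ])

lemma cokernelToHomology_naturality {K L : CochainComplex AddCommGrpCat.{w} ℕ} (φ : K ⟶ L)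
    (k : ℕ) {Q Q' : AddCommGrpCat.{w}}
    (p : K.X k ⟶ Q) (a : Q ⟶ K.X (k + 1)) (e : p ≫ a = K.d k (k + 1))
    (z : a ≫ K.d (k + 1) (k + 2) = 0)
    (p' : L.X k ⟶ Q') (a' : Q' ⟶ L.X (k + 1)) (e' : p' ≫ a' = L.d k (k + 1))
    (z' : a' ≫ L.d (k + 1) (k + 2) = 0) (q : Q ⟶ Q')
    (hp : p ≫ q = φ.f k ≫ p') (ha : a ≫ φ.f (k + 1) = q ≫ a') :
    cokernel.map p p' (φ.f k) q hp ≫ cokernelToHomology L k p' a' e' z' =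
      cokernelToHomology K k p a e z ≫ HomologicalComplex.homologyMap φ (k + 1) := by
  have : q ≫ L.liftCycles a' (k + 2) (by simp) z' =
      K.liftCycles a (k + 2) (by simp) z ≫ HomologicalComplex.cyclesMap φ (k + 1) := by
    rw [← cancel_mono (L.iCycles (k + 1))]
    simp [ha]
  rw [← cancel_epi (cokernel.π p)]
  simp [cokernelToHomology, reassoc_of% this]

/-- Given a complex `K`, a map `q : K.X i ⟶ F(Z)` that vanishes on boundaries, and an embedding of
`Z` in an injective object `J` such that the composite `K.X i ⟶ F(Z) ⟶ F(J)` vanishes on cycles,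
the map `Hⁱ(K) ⟶ F̄(Z)` induced by `q`. -/
def homologyToSubStab (K : CochainComplex AddCommGrpCat.{w} ℕ) (i : ℕ) {Z J : A}
    (q : K.X i ⟶ F.obj Z) (hb : ∀ l, K.d l i ≫ q = 0) (j : Z ⟶ J) [Mono j] [Injective J]
    (hq : K.iCycles i ≫ q ≫ F.map j = 0) : K.homology i ⟶ (subStab F).obj Z :=
  subStabLift F (K.homologyι i ≫ K.descOpcycles q _ rfl (hb _)) j (by
    rw [← cancel_epi (K.homologyπ i)]
    simpa using hq)

lemma homologyToSubStab_naturality {K L : CochainComplex AddCommGrpCat.{w} ℕ} (φ : K ⟶ L)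
    (i : ℕ) {Z J Z' J' : A} (q : K.X i ⟶ F.obj Z) (hb : ∀ l, K.d l i ≫ q = 0) (j : Z ⟶ J)
    [Mono j] [Injective J] (hq : K.iCycles i ≫ q ≫ F.map j = 0)
    (q' : L.X i ⟶ F.obj Z') (hb' : ∀ l, L.d l i ≫ q' = 0) (j' : Z' ⟶ J')
    [Mono j'] [Injective J'] (hq' : L.iCycles i ≫ q' ≫ F.map j' = 0)
    (s : Z ⟶ Z') (hs : φ.f i ≫ q' = q ≫ F.map s) :
    HomologicalComplex.homologyMap φ i ≫ homologyToSubStab F L i q' hb' j' hq' =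
      homologyToSubStab F K i q hb j hq ≫ (subStab F).map s := by
  rw [← cancel_mono ((subStabι F).app Z'), ← cancel_epi (K.homologyπ i)]
  simp [homologyToSubStab, hs]

/-- The complex `F(I⁰) ⟶ F(I¹) ⟶ ⋯`, where `I` is the chosen resolution of `B`. -/
abbrev mapRes (B : A) : CochainComplex AddCommGrpCat.{w} ℕ :=
  (F.mapHomologicalComplex _).obj (res B)

/-- The components of `Sᵏ⁺¹F ⟶ Rᵏ⁺¹F`, induced by `F(Σᵏ⁺¹ B) ⟶ Ker (F(Iᵏ⁺¹) ⟶ F(Iᵏ⁺²))`. -/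
def satelliteToHomology (B : A) (k : ℕ) : satelliteObj F B k ⟶ (mapRes F B).homology (k + 1) :=
  cokernelToHomology (mapRes F B) k (F.map ((res B).toCycles k (k + 1)))
    (F.map ((res B).iCycles (k + 1)))
    ((F.map_comp _ _).symm.trans (congrArg F.map ((res B).toCycles_i k (k + 1))))
    ((F.map_comp _ _).symm.trans
      ((congrArg F.map ((res B).iCycles_d (k + 1) (k + 2))).trans (F.map_zero _ _)))

/-- `Sᵏ⁺¹F ⟶ Rᵏ⁺¹F`. -/
def satelliteToRightDerived (k : ℕ) : satellite F k ⟶ F.rightDerived (k + 1) where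
  app B := satelliteToHomology F B k ≫
    ((injectiveResolution B).isoRightDerivedObj F (k + 1)).inv
  naturality B B' f := by
    have h₁ : satelliteMap F f k ≫ satelliteToHomology F B' k =
        satelliteToHomology F B k ≫ HomologicalComplex.homologyMap
          ((F.mapHomologicalComplex _).map (resMap f)) (k + 1) :=
      cokernelToHomology_naturality ((F.mapHomologicalComplex _).map (resMap f)) k
        (F.map ((res B).toCycles k (k + 1))) (F.map ((res B).iCycles (k + 1))) _ _
        (F.map ((res B').toCycles k (k + 1))) (F.map ((res B').iCycles (k + 1))) _ _
        (F.map (cosyzygyMap f (k + 1))) (toCycles_naturality F f k).symm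
        ((F.map_comp _ _).symm.trans ((congrArg F.map
          (HomologicalComplex.cyclesMap_i (resMap f) (k + 1)).symm).trans (F.map_comp _ _)))
    have h₂ := InjectiveResolution.isoRightDerivedObj_inv_naturality f
      (injectiveResolution B) (injectiveResolution B') (resMap f)
      (InjectiveResolution.desc_commutes_zero f _ _) F (k + 1)
    exact square_comp h₁ h₂.symm

/-- The components of `RⁱF ⟶ F̄ ∘ Σⁱ⁺¹`, induced by `F(Iⁱ) ⟶ F(Σⁱ⁺¹ B)`. -/
def rightDerivedToSubStabApp (B : A) (i : ℕ) :
    (mapRes F B).homology i ⟶ (subStab F).obj (cosyzygy B (i + 1)) :=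
  homologyToSubStab F (mapRes F B) i (F.map ((res B).toCycles i (i + 1)))
    (fun l => (F.map_comp _ _).symm.trans
      ((congrArg F.map (d_comp_toCycles (res B) l i)).trans (F.map_zero _ _)))
    ((res B).iCycles (i + 1))
    ((congrArg (_ ≫ ·) ((F.map_comp _ _).symm.trans
      (congrArg F.map ((res B).toCycles_i i (i + 1))))).trans ((mapRes F B).iCycles_d i (i + 1)))

/-- `RⁱF ⟶ F̄ ∘ Σⁱ⁺¹`. -/
def rightDerivedToSubStab (i : ℕ) : F.rightDerived i ⟶ subStabCosyzygy F i where
  app B := ((injectiveResolution B).isoRightDerivedObj F i).hom ≫ rightDerivedToSubStabApp F B i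
  naturality B B' f := by
    have h₁ : HomologicalComplex.homologyMap ((F.mapHomologicalComplex _).map (resMap f)) i ≫
        rightDerivedToSubStabApp F B' i =
        rightDerivedToSubStabApp F B i ≫ (subStab F).map (cosyzygyMap f (i + 1)) :=
      homologyToSubStab_naturality F ((F.mapHomologicalComplex _).map (resMap f)) i
        (F.map ((res B).toCycles i (i + 1))) _ _ _ (F.map ((res B').toCycles i (i + 1))) _ _ _
        (cosyzygyMap f (i + 1)) (toCycles_naturality F f i)
    have h₂ := InjectiveResolution.isoRightDerivedObj_hom_naturality f
      (injectiveResolution B) (injectiveResolution B') (resMap f)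
      (InjectiveResolution.desc_commutes_zero f _ _) F i
    exact square_comp h₂ h₁

/-- The right fundamental sequence of an additive functor `F`,
`0 ⟶ F̄ ⟶ F ⟶ R⁰F ⟶ F̄ ∘ Σ ⟶ S¹F ⟶ R¹F ⟶ F̄ ∘ Σ² ⟶ S²F ⟶ R²F ⟶ ⋯`. -/
def rightFundamentalSeq : LongSeq.{w} A where
  X
    | 0 => subStab F
    | k + 1 => subStabCosyzygy F k
  Y
    | 0 => F
    | k + 1 => satellite F k
  Z i := F.rightDerived i
  f
    | 0 => subStabι F
    | k + 1 => subStabToSatellite F k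
  g
    | 0 => F.toRightDerivedZero
    | k + 1 => satelliteToRightDerived F k
  h i := rightDerivedToSubStab F i

end Functors

/-! ### Cohomology of a complex with coefficients -/

section Cohomology

variable (C : ChainComplex A ℤ)

/-- The cochain complex `Hom(C, M)`, with `Hom(Cₙ, M)` in degree `n`. -/
def homComplex : A ⥤ CochainComplex AddCommGrpCat.{v} ℤ where
  obj M :=
    { X := fun i => AddCommGrpCat.of (C.X i ⟶ M)
      d := fun i j => AddCommGrpCat.ofHom (Preadditive.leftComp M (C.d j i))
      shape := fun i j h => by
        ext x
        have e : C.d j i = 0 := C.shape j i h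
        change C.d j i ≫ x = 0
        rw [e, zero_comp]
      d_comp_d' := fun i j k _ _ => by
        ext x
        change C.d k j ≫ C.d j i ≫ x = 0
        rw [← Category.assoc, C.d_comp_d, zero_comp] }
  map f :=
    { f := fun i => AddCommGrpCat.ofHom (Preadditive.rightComp (C.X i) f)
      comm' := fun i j _ => by
        ext x
        exact (Category.assoc (C.d j i) x f).symm }
  map_id M := by
    ext i x
    exact Category.comp_id (X := C.X i) (Y := M) x
  map_comp {M N P} f g := by
    ext i x
    exact (Category.assoc (W := C.X i) x f g).symm

instance : (homComplex C).Additive where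
  map_add {M N} {f g} := by
    ext i x
    exact Preadditive.comp_add (C := A) (C.X i) M N x f g

/-- The `n`-th cohomology functor `Hⁿ(C, -)`. -/
def cohomology (n : ℤ) : A ⥤ AddCommGrpCat.{v} :=
  homComplex C ⋙ HomologicalComplex.homologyFunctor AddCommGrpCat.{v} (ComplexShape.up ℤ) n

instance (n : ℤ) : (cohomology C n).Additive := by
  unfold cohomology; infer_instance

/-- The functor `Extⁱ(X, -)`. (The needed smallness holds in any category with enough
injectives.) -/
def ext [EnoughInjectives A] (X : A) (i : ℕ) : A ⥤ AddCommGrpCat.{v} :=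
  haveI : HasExt.{v} A := hasExt_of_enoughInjectives.{v} A
  Abelian.extFunctorObj X i

/-- A transformation `Hⁿ(C, -) ⟶ (Hₙ(C), -)` is the canonical one if it sends the class of a
cocycle `z : Cₙ ⟶ M` to the map `Hₙ(C) ⟶ M` induced by the restriction of `z` to the cycles. -/
def IsCanonical (n : ℤ)
    (ρ : cohomology C n ⟶ preadditiveCoyoneda.obj (Opposite.op (C.homology n))) : Prop :=
  ∀ (M : A) (z : ((homComplex C).obj M).cycles n) (z₀ : C.X n ⟶ M) (r : C.homology n ⟶ M),
    ((homComplex C).obj M).iCycles n z = z₀ →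
    ρ.app M (((homComplex C).obj M).homologyπ n z) = r →
      C.homologyπ n ≫ r = C.iCycles n ≫ z₀

variable [EnoughInjectives A] (n : ℤ)

/-- The functors `Extⁱ⁺¹(Cₙ₋₁/Bₙ₋₁, -)`; here `C.opcycles i` is `Cᵢ/Bᵢ`. -/
def ucX (i : ℕ) : A ⥤ AddCommGrpCat.{v} := ext (C.opcycles (n - 1)) (i + 1)

/-- The functors `Hⁿ(C, -)`, `Ext¹(Cₙ/Bₙ, -)`, `Ext²(Cₙ/Bₙ, -)`, ... -/
def ucY : ℕ → (A ⥤ AddCommGrpCat.{v})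
  | 0 => cohomology C n
  | k + 1 => ext (C.opcycles n) (k + 1)

/-- The functors `(Hₙ(C), -)`, `Ext¹(Hₙ(C), -)`, `Ext²(Hₙ(C), -)`, ... -/
def ucZ : ℕ → (A ⥤ AddCommGrpCat.{v})
  | 0 => preadditiveCoyoneda.obj (Opposite.op (C.homology n))
  | k + 1 => ext (C.homology n) (k + 1)

end Cohomology

end FundSeq

end

/-! The functor `F = Hⁿ(C, -)` is finitely presented: a cocycle `Cₙ ⟶ M` is a map `Cₙ/Bₙ ⟶ M`, and
it is a coboundary exactly when it factors through `δ : Cₙ/Bₙ ⟶ Cₙ₋₁`. So `F` is the cokernel of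
`(P, -) ⟶ (D, -)`, where `D = Cₙ/Bₙ` and `P = Cₙ₋₁` is projective. Everything is read off from `δ :
D ⟶ P`, whose kernel is `Hₙ(C)` and whose cokernel is `Cₙ₋₁/Bₙ₋₁`.

Since `P` is projective, `F` is half exact (`Presentation.isHalfExact`), and the fundamental
sequence of a half exact functor is exact (`rightFundamentalSeq_isExact`).

The three families of terms come from three features of `δ`. The class of `D ⟶ M` dies in an
injective object iff the map factors through the image of `δ`. Hence `F̄` is presented by `im δ ⟶
P`, which gives `Ext¹(coker δ, -)` (`Presentation.subStabIso`), and dimension shifting gives `F̄ ∘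
Σᵏ`. A map `D ⟶ Σᵏ⁺¹B` through `P` lifts to `Iᵏ`, so `Sᵏ⁺¹F(B)` is `Hom(D, Σᵏ⁺¹B)` modulo the maps
through `Iᵏ`, which is `Extᵏ⁺¹(D, B)` (`Presentation.satelliteIso`). On injective objects `F` agrees
with `(ker δ, -)`, so both have the same right derived functors (`isIso_rightDerived`).

The maps of the Ext sequence are obtained by transport along these isomorphisms; naturality of `ρ`
identifies the map out of `Hⁿ(C, -)` with the canonical one. -/

noncomputable section

namespace FundSeq

open Abelian Opposite

/-! ### Elements of cycles and homology in complexes of abelian groups -/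

section Elements

variable {ι : Type*} {c : ComplexShape ι} (K : HomologicalComplex AddCommGrpCat.{w} c)

lemma homologyπ_surjective (i : ι) : Function.Surjective (K.homologyπ i) :=
  (AddCommGrpCat.epi_iff_surjective _).1 inferInstance

lemma iCycles_injective (i : ι) : Function.Injective (K.iCycles i) :=
  (AddCommGrpCat.mono_iff_injective _).1 inferInstance

lemma exists_cycle {i j : ι} (h : c.next i = j) (x : K.X i) (hx : K.d i j x = 0) :
    ∃ z : K.cycles i, K.iCycles i z = x :=
  (ShortComplex.ab_exact_iff _).1
    (ShortComplex.exact_of_f_is_kernel (.mk _ _ (K.iCycles_d i j)) (K.cyclesIsKernel i j h)) x hx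

lemma exists_boundary {i j : ι} (h : c.prev j = i) (z : K.cycles j) (hz : K.homologyπ j z = 0) :
    ∃ y : K.X i, K.toCycles i j y = z :=
  (ShortComplex.ab_exact_iff _).1
    (ShortComplex.exact_of_g_is_cokernel (.mk _ _ (K.toCycles_comp_homologyπ i j))
      (K.homologyIsCokernel i j h)) z hz

end Elements

/-! ### Exactness of the right fundamental sequence of a half exact functor -/

section Exactness

variable {A : Type u} [Category.{v} A] [Abelian A] [EnoughInjectives A]

/-- The short complex `Σᵏ B ⟶ Iᵏ ⟶ Σᵏ⁺¹ B`. -/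
abbrev cosyzygySeq (B : A) (k : ℕ) : ShortComplex A :=
  .mk ((res B).iCycles k) ((res B).toCycles k (k + 1)) (by
    rw [← cancel_mono ((res B).iCycles (k + 1))]; simp)

lemma cosyzygySeq_shortExact (B : A) (k : ℕ) : (cosyzygySeq B k).ShortExact where
  exact := by
    refine ShortComplex.exact_of_f_is_kernel _ ?_
    refine KernelFork.IsLimit.ofι' _ _ fun {W} x hx => ?_
    have hx' : x ≫ (res B).d k (k + 1) = 0 := by
      rw [← (res B).toCycles_i, ← Category.assoc]
      exact (congrArg (· ≫ _) hx).trans zero_comp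
    exact ⟨(res B).liftCycles x (k + 1) (by simp) hx', (res B).liftCycles_i _ _ _ _⟩
  mono_f := inferInstanceAs (Mono ((res B).iCycles k))
  -- The cokernel of `Iᵏ ⟶ Σᵏ⁺¹ B` is the homology of the resolution in degree `k + 1`, which
  -- vanishes.
  epi_g := Preadditive.epi_of_isZero_cokernel' _
    ((res B).homologyIsCokernel k (k + 1) (by simp))
    ((injectiveResolution B).cocomplex_exactAt_succ k).isZero_homology

instance (B : A) (k : ℕ) : Injective ((res B).X k) := (injectiveResolution B).injective k

variable (F : A ⥤ AddCommGrpCat.{w}) [F.Additive]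

/-- A functor is half exact if it maps short exact sequences to sequences that are exact in the
middle. -/
def IsHalfExact {A : Type u} [Category.{v} A] [Abelian A] (F : A ⥤ AddCommGrpCat.{w}) : Prop :=
  ∀ S : ShortComplex A, S.ShortExact → Function.Exact (F.map S.f) (F.map S.g)

lemma map_comp_apply {A : Type u} [Category.{v} A] (F : A ⥤ AddCommGrpCat.{w}) {X Y Z : A}
    (f : X ⟶ Y) (g : Y ⟶ Z) (x : F.obj X) :
    F.map g (F.map f x) = F.map (f ≫ g) x := by
  rw [F.map_comp]; rfl

lemma subStabι_injective (B : A) : Function.Injective ((subStabι F).app B) :=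
  (AddCommGrpCat.mono_iff_injective _).1 inferInstance

lemma exists_subStab {B J : A} (j : B ⟶ J) [Mono j] [Injective J] (x : F.obj B)
    (hx : F.map j x = 0) : ∃ y, (subStabι F).app B y = x := by
  have h₁ : kernel.ι (F.map j) ≫ F.map j = 0 := kernel.condition _
  obtain ⟨y, rfl⟩ := (ShortComplex.ab_exact_iff _).1
    (ShortComplex.exact_of_f_is_kernel (.mk _ _ h₁) (kernelIsKernel (F.map j))) x hx
  exact ⟨subStabLift F _ j h₁ y, ConcreteCategory.congr_hom (subStabLift_ι F _ j h₁) y⟩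

lemma map_subStabι {B J : A} [Injective J] (j : B ⟶ J) (x : (subStab F).obj B) :
    F.map j ((subStabι F).app B x) = 0 :=
  ConcreteCategory.congr_hom (subStabι_app_comp_map F j) x

lemma homologyToSubStab_homologyπ (K : CochainComplex AddCommGrpCat.{w} ℕ) (i : ℕ) {Z J : A}
    (q : K.X i ⟶ F.obj Z) (hb : ∀ l, K.d l i ≫ q = 0) (j : Z ⟶ J) [Mono j] [Injective J]
    (hq : K.iCycles i ≫ q ≫ F.map j = 0) (z : K.cycles i) :
    (subStabι F).app Z (homologyToSubStab F K i q hb j hq (K.homologyπ i z)) =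
      q (K.iCycles i z) := by
  have : K.homologyπ i ≫ homologyToSubStab F K i q hb j hq ≫ (subStabι F).app Z =
      K.iCycles i ≫ q := by simp [homologyToSubStab]
  exact ConcreteCategory.congr_hom this z

lemma rightDerivedToSubStabApp_homologyπ (B : A) (i : ℕ) (z : (mapRes F B).cycles i) :
    (subStabι F).app _ (rightDerivedToSubStabApp F B i ((mapRes F B).homologyπ i z)) =
      F.map ((res B).toCycles i (i + 1)) ((mapRes F B).iCycles i z) :=
  homologyToSubStab_homologyπ _ _ _ _ _ _ _ _

/-- The lift of `F(Σⁱ B) ⟶ F(Iⁱ)` to the cycles. -/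
def toMapResCycles (B : A) (i : ℕ) : F.obj (cosyzygy B i) ⟶ (mapRes F B).cycles i :=
  (mapRes F B).liftCycles (F.map ((res B).iCycles i)) (i + 1) (by simp)
    ((F.map_comp _ _).symm.trans
      ((congrArg F.map ((res B).iCycles_d i (i + 1))).trans (F.map_zero _ _)))

lemma iCycles_toMapResCycles (B : A) (i : ℕ) (x : F.obj (cosyzygy B i)) :
    (mapRes F B).iCycles i (toMapResCycles F B i x) = F.map ((res B).iCycles i) x :=
  ConcreteCategory.congr_hom ((mapRes F B).liftCycles_i _ _ _ _) x

lemma satelliteToHomology_π (B : A) (k : ℕ) (x : F.obj (cosyzygy B (k + 1))) :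
    satelliteToHomology F B k (cokernel.π (F.map ((res B).toCycles k (k + 1))) x) =
      (mapRes F B).homologyπ (k + 1) (toMapResCycles F B (k + 1) x) := by
  have : cokernel.π (F.map ((res B).toCycles k (k + 1))) ≫ satelliteToHomology F B k =
      toMapResCycles F B (k + 1) ≫ (mapRes F B).homologyπ (k + 1) := cokernel.π_desc _ _ _
  exact ConcreteCategory.congr_hom this x

lemma cokernelπ_surjective {X Y : AddCommGrpCat.{w}} (f : X ⟶ Y) :
    Function.Surjective (cokernel.π f) :=
  (AddCommGrpCat.epi_iff_surjective _).1 inferInstance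

lemma cokernelπ_eq_zero_iff {X Y : AddCommGrpCat.{w}} (f : X ⟶ Y) (y : Y) :
    cokernel.π f y = 0 ↔ ∃ x, f x = y :=
  (ShortComplex.ab_exact_iff_function_exact _).1
    (ShortComplex.exact_of_g_is_cokernel (.mk _ _ (cokernel.condition f)) (cokernelIsCokernel f)) y

lemma exact_subStab_satellite_homology (B : A) (k : ℕ) :
    Function.Exact ((subStabToSatellite F k).app B) (satelliteToHomology F B k) := by
  intro s
  constructor
  · intro hs
    obtain ⟨x, rfl⟩ := cokernelπ_surjective _ s
    rw [satelliteToHomology_π] at hs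
    obtain ⟨y, hy⟩ : ∃ y : F.obj ((res B).X k),
        (mapRes F B).toCycles k (k + 1) y = toMapResCycles F B (k + 1) x :=
      exists_boundary (mapRes F B) (by simp) _ hs
    -- Subtracting the image of `y` leaves the class in the satellite unchanged and makes the
    -- representative vanish in `F(Iᵏ⁺¹)`, so that it lies in `F̄`.
    have h : F.map ((res B).iCycles (k + 1)) (x - F.map ((res B).toCycles k (k + 1)) y) = 0 := by
      rw [map_sub, sub_eq_zero, map_comp_apply, ← iCycles_toMapResCycles, ← hy]
      rw [(res B).toCycles_i k (k + 1)]
      exact ConcreteCategory.congr_hom ((mapRes F B).toCycles_i k (k + 1)) y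
    obtain ⟨t, ht⟩ := exists_subStab F _ _ h
    refine ⟨t, ?_⟩
    have h₁ : (subStabToSatellite F k).app B t = cokernel.π (F.map ((res B).toCycles k (k + 1)))
        ((subStabι F).app _ t) := rfl
    rw [h₁, ht, map_sub, (cokernelπ_eq_zero_iff _ _).2 ⟨y, rfl⟩]
    exact sub_zero _
  · rintro ⟨t, rfl⟩
    refine (satelliteToHomology_π F B k ((subStabι F).app _ t)).trans ?_
    have : toMapResCycles F B (k + 1) ((subStabι F).app _ t) = 0 := by
      apply iCycles_injective
      rw [iCycles_toMapResCycles, map_zero]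
      exact map_subStabι _ _ _
    rw [this, map_zero]

lemma exact_homology_subStab_satellite (B : A) (k : ℕ) :
    Function.Exact (rightDerivedToSubStabApp F B k) ((subStabToSatellite F k).app B) := by
  intro t
  constructor
  · intro ht
    obtain ⟨y, hy⟩ := (cokernelπ_eq_zero_iff _ ((subStabι F).app _ t)).1 ht
    -- `y` is a cycle because its image in `F(Σᵏ⁺¹ B)` lies in `F̄` and so vanishes in the injective
    -- object `Iᵏ⁺¹`.
    obtain ⟨z, hz⟩ := exists_cycle (mapRes F B) (j := k + 1) (by simp) y (by
      have : F.map ((res B).toCycles k (k + 1) ≫ (res B).iCycles (k + 1)) y = 0 := by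
        rw [← map_comp_apply, hy, map_subStabι]
      rwa [(res B).toCycles_i] at this)
    refine ⟨(mapRes F B).homologyπ k z, subStabι_injective F _ ?_⟩
    rw [rightDerivedToSubStabApp_homologyπ, hz, hy]
  · rintro ⟨x, rfl⟩
    obtain ⟨z, rfl⟩ := homologyπ_surjective _ _ x
    refine (cokernelπ_eq_zero_iff _ _).2 ⟨(mapRes F B).iCycles k z, ?_⟩
    exact (rightDerivedToSubStabApp_homologyπ F B k z).symm

/-- The map `F(Σⁱ B) ⟶ Hⁱ(F(I))`. -/
def toMapResHomology (B : A) (i : ℕ) : F.obj (cosyzygy B i) ⟶ (mapRes F B).homology i :=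
  toMapResCycles F B i ≫ (mapRes F B).homologyπ i

/-- Half exactness for `Σⁱ B ⟶ Iⁱ ⟶ Σⁱ⁺¹ B`; it is needed only for exactness at the terms `RⁱF`. Up
to isomorphism the map on the left is `ρ_F` for `i = 0`, and for `i = k + 1` it has the same image
as `Sᵏ⁺¹F ⟶ Rᵏ⁺¹F`, so all these terms are treated at once. -/
lemma exact_toMapResHomology (hF : IsHalfExact F) (B : A) (i : ℕ) :
    Function.Exact (toMapResHomology F B i) (rightDerivedToSubStabApp F B i) := by
  intro x
  constructor
  · intro hx
    obtain ⟨z, rfl⟩ := homologyπ_surjective _ _ x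
    have h := rightDerivedToSubStabApp_homologyπ F B i z
    rw [hx, map_zero] at h
    obtain ⟨y, hy⟩ := (hF _ (cosyzygySeq_shortExact B i) _).1 h.symm
    refine ⟨y, congrArg ((mapRes F B).homologyπ i) (iCycles_injective _ _ ?_)⟩
    exact (iCycles_toMapResCycles F B i y).trans hy
  · rintro ⟨y, rfl⟩
    refine subStabι_injective F _ ((rightDerivedToSubStabApp_homologyπ F B i _).trans ?_)
    rw [map_zero]
    exact (congrArg (F.map ((res B).toCycles i (i + 1))) (iCycles_toMapResCycles F B i y)).trans
      ((hF _ (cosyzygySeq_shortExact B i) _).2 ⟨y, rfl⟩)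

/-- The canonical isomorphism of an object with its zeroth cosyzygy. -/
def cosyzygyZeroIso (B : A) : B ≅ cosyzygy B 0 :=
  (injectiveResolution B).isLimitKernelFork.conePointUniqueUpToIso
    ((res B).cyclesIsKernel 0 1 (by simp))

lemma cosyzygyZeroIso_hom_comp (B : A) :
    (cosyzygyZeroIso B).hom ≫ (res B).iCycles 0 = (injectiveResolution B).ι.f 0 :=
  IsLimit.conePointUniqueUpToIso_hom_comp _ _ WalkingParallelPair.zero

lemma toRightDerivedZero_app_comp (B : A) :
    F.toRightDerivedZero.app B ≫ ((injectiveResolution B).isoRightDerivedObj F 0).hom =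
      F.map (cosyzygyZeroIso B).hom ≫ toMapResHomology F B 0 := by
  have : (injectiveResolution B).toRightDerivedZero' F =
      F.map (cosyzygyZeroIso B).hom ≫ toMapResCycles F B 0 := by
    rw [← cancel_mono ((mapRes F B).iCycles 0)]
    refine ((injectiveResolution B).toRightDerivedZero'_comp_iCycles F).trans ?_
    refine ((congrArg F.map (cosyzygyZeroIso_hom_comp B).symm).trans (F.map_comp _ _)).trans ?_
    rw [Category.assoc]
    exact congrArg (F.map _ ≫ ·) ((mapRes F B).liftCycles_i _ _ _ _).symm
  rw [(injectiveResolution B).toRightDerivedZero_eq F, this, Category.assoc, Category.assoc,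
    toMapResHomology]
  refine congrArg (F.map _ ≫ toMapResCycles F B 0 ≫ ·) ?_
  exact (Category.assoc _ _ _).trans ((congrArg (_ ≫ ·) (Iso.inv_hom_id _)).trans
    (Category.comp_id _))

lemma toMapResHomology_succ (B : A) (k : ℕ) :
    toMapResHomology F B (k + 1) =
      cokernel.π (F.map ((res B).toCycles k (k + 1))) ≫ satelliteToHomology F B k :=
  (cokernel.π_desc _ _ _).symm

lemma exact_satelliteToHomology (hF : IsHalfExact F) (B : A) (k : ℕ) :
    Function.Exact (satelliteToHomology F B k) (rightDerivedToSubStabApp F B (k + 1)) := by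
  intro x
  rw [exact_toMapResHomology F hF B (k + 1) x, toMapResHomology_succ]
  constructor
  · rintro ⟨y, rfl⟩
    exact ⟨_, rfl⟩
  · rintro ⟨y, rfl⟩
    obtain ⟨y, rfl⟩ := cokernelπ_surjective _ y
    exact ⟨y, rfl⟩

lemma exact_subStabι (B : A) :
    Function.Exact ((subStabι F).app B) (F.toRightDerivedZero.app B) :=
  (ShortComplex.ab_exact_iff_function_exact _).1
    (ShortComplex.exact_of_f_is_kernel (.mk _ _ (subStabι_comp_app F B)) (subStabAppIsLimit F B))

lemma exact_comp_iso {X Y Y' Z : AddCommGrpCat.{w}} {f : X ⟶ Y} {g : Y ⟶ Z} (e : Y' ≅ Y)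
    (h : Function.Exact f g) : Function.Exact (f ≫ e.inv) (e.hom ≫ g) := by
  intro y
  refine (h (e.hom y)).trans ⟨?_, ?_⟩
  · rintro ⟨x, hx⟩
    exact ⟨x, (congrArg e.inv hx).trans (ConcreteCategory.congr_hom e.hom_inv_id y)⟩
  · rintro ⟨x, rfl⟩
    exact ⟨x, (ConcreteCategory.congr_hom e.inv_hom_id (f x)).symm⟩

lemma iso_hom_surjective {X Y : AddCommGrpCat.{w}} (e : X ≅ Y) : Function.Surjective e.hom :=
  fun y => ⟨e.inv y, ConcreteCategory.congr_hom e.inv_hom_id y⟩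

lemma iso_hom_injective {X Y : AddCommGrpCat.{w}} (e : X ≅ Y) : Function.Injective e.hom :=
  (AddCommGrpCat.mono_iff_injective _).1 inferInstance

/-- The right fundamental sequence of a half exact additive functor is exact. -/
theorem rightFundamentalSeq_isExact (hF : IsHalfExact F) : (rightFundamentalSeq F).IsExact where
  injective B := subStabι_injective F B
  exact_Y
    | 0, B => exact_subStabι F B
    | k + 1, B => by
      intro x
      refine Iff.trans ?_ (exact_subStab_satellite_homology F B k x)
      change ((injectiveResolution B).isoRightDerivedObj F (k + 1)).symm.hom _ = 0 ↔ _
      exact map_eq_zero_iff _ (iso_hom_injective _)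
  exact_Z
    | 0, B => by
      have h := exact_toMapResHomology F hF B 0
      have h' := exact_comp_iso ((injectiveResolution B).isoRightDerivedObj F 0) h
      intro x
      refine (h' x).trans ?_
      have e : F.toRightDerivedZero.app B = F.map (cosyzygyZeroIso B).hom ≫
          toMapResHomology F B 0 ≫ ((injectiveResolution B).isoRightDerivedObj F 0).inv :=
        ((Iso.eq_comp_inv _).2 (toRightDerivedZero_app_comp F B)).trans (Category.assoc _ _ _)
      change _ ↔ x ∈ Set.range (F.toRightDerivedZero.app B)
      rw [e]
      constructor
      · rintro ⟨y, rfl⟩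
        obtain ⟨y, rfl⟩ := iso_hom_surjective (F.mapIso (cosyzygyZeroIso B)) y
        exact ⟨y, rfl⟩
      · rintro ⟨y, rfl⟩
        exact ⟨_, rfl⟩
    | k + 1, B =>
      exact_comp_iso ((injectiveResolution B).isoRightDerivedObj F (k + 1))
        (exact_satelliteToHomology F hF B k)
  exact_X k B := by
    intro x
    refine (exact_homology_subStab_satellite F B k x).trans ⟨?_, ?_⟩
    · rintro ⟨y, rfl⟩
      obtain ⟨y, rfl⟩ := iso_hom_surjective ((injectiveResolution B).isoRightDerivedObj F k) y
      exact ⟨y, rfl⟩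
    · rintro ⟨y, rfl⟩
      exact ⟨_, rfl⟩

end Exactness

/-! ### Dimension shifting: Ext groups as maps into cosyzygies -/

section CosyzygyClass

variable {A : Type u} [Category.{v} A] [Abelian A] [EnoughInjectives A] [HasExt.{v} A]

/-- The class in `Extᵏ(Σᵏ B, B)` of the exact sequence `0 ⟶ B ⟶ I⁰ ⟶ ⋯ ⟶ Iᵏ⁻¹ ⟶ Σᵏ B ⟶ 0`. -/
def cosyzygyClass (B : A) : ∀ k : ℕ, Ext.{v} (cosyzygy B k) B k
  | 0 => Ext.mk₀ (cosyzygyZeroIso B).inv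
  | k + 1 => (cosyzygySeq_shortExact B k).extClass.comp (cosyzygyClass B k) (add_comm 1 k)

omit [HasExt.{v} A] in
lemma cosyzygyZeroIso_naturality {B B' : A} (f : B ⟶ B') :
    cosyzygyMap f 0 ≫ (cosyzygyZeroIso B').inv = (cosyzygyZeroIso B).inv ≫ f := by
  rw [Iso.comp_inv_eq, Category.assoc, Iso.eq_inv_comp, ← cancel_mono ((res B').iCycles 0),
    Category.assoc, Category.assoc, HomologicalComplex.cyclesMap_i, ← Category.assoc]
  refine (congrArg (· ≫ (resMap f).f 0) (cosyzygyZeroIso_hom_comp B)).trans ?_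
  refine (InjectiveResolution.desc_commutes_zero f _ _).trans ?_
  exact congrArg (f ≫ ·) (cosyzygyZeroIso_hom_comp B').symm

/-- The morphism of short complexes induced by a lift of a morphism to the resolutions. -/
def cosyzygySeqMap {A : Type u} [Category.{v} A] [Abelian A] [EnoughInjectives A]
    {B B' : A} (f : B ⟶ B') (k : ℕ) : cosyzygySeq B k ⟶ cosyzygySeq B' k where
  τ₁ := cosyzygyMap f k
  τ₂ := (resMap f).f k
  τ₃ := cosyzygyMap f (k + 1)
  comm₁₂ := HomologicalComplex.cyclesMap_i _ _
  comm₂₃ := by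
    rw [← cancel_mono (HomologicalComplex.iCycles _ _)]
    simp

lemma cosyzygyClass_naturality {B B' : A} (f : B ⟶ B') (k : ℕ) :
    (Ext.mk₀ (cosyzygyMap f k)).comp (cosyzygyClass B' k) (zero_add k) =
      (cosyzygyClass B k).comp (Ext.mk₀ f) (add_zero k) := by
  induction k with
  | zero =>
    simp only [cosyzygyClass, Ext.mk₀_comp_mk₀]
    exact congrArg Ext.mk₀ (cosyzygyZeroIso_naturality f)
  | succ k ih =>
    have h := ShortComplex.ShortExact.extClass_naturality (cosyzygySeq_shortExact B k)
      (cosyzygySeq_shortExact B' k) (cosyzygySeqMap f k)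
    simp only [cosyzygyClass]
    rw [Ext.comp_assoc_of_third_deg_zero, ← ih]
    rw [← Ext.comp_assoc _ _ _ (zero_add 1) (add_comm 1 k) (by omega)]
    refine (congrArg (fun x => Ext.comp x (cosyzygyClass B' k) (add_comm 1 k)) h.symm).trans ?_
    exact Ext.comp_assoc_of_second_deg_zero _ _ _ _

/-- In the long exact sequence of `Σᵏ B ⟶ Iᵏ ⟶ Σᵏ⁺¹ B` the neighbouring groups `Extᵐ(X, Iᵏ)` and
`Extᵐ⁺¹(X, Iᵏ)` vanish. For `m = 0` the first need not vanish, hence the condition `0 < m`. -/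
lemma comp_extClass_bijective (X B : A) (k : ℕ) {m n : ℕ} (hm : 0 < m) (h : m + 1 = n) :
    Function.Bijective (fun x : Ext X (cosyzygy B (k + 1)) m =>
      x.comp (cosyzygySeq_shortExact B k).extClass h) := by
  obtain ⟨m, rfl⟩ := Nat.exists_eq_succ_of_ne_zero hm.ne'
  constructor
  · refine (injective_iff_map_eq_zero
      ((cosyzygySeq_shortExact B k).extClass.postcomp X h)).2 fun x hx => ?_
    obtain ⟨y, rfl⟩ := Ext.covariant_sequence_exact₃ X (cosyzygySeq_shortExact B k) x h hx
    rw [Ext.eq_zero_of_injective y, Ext.zero_comp]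
  · intro y
    subst h
    exact Ext.covariant_sequence_exact₁ X (cosyzygySeq_shortExact B k) y
      (Ext.eq_zero_of_injective _) rfl

omit [EnoughInjectives A] in
lemma comp_mk₀_iso_bijective (X : A) {Y Z : A} (e : Y ≅ Z) {n m : ℕ} (h : n + 0 = m) :
    Function.Bijective (fun x : Ext.{v} X Y n => x.comp (Ext.mk₀ e.hom) h) := by
  obtain rfl : n = m := h
  refine Function.bijective_iff_has_inverse.2
    ⟨fun x => x.comp (Ext.mk₀ e.inv) (add_zero _), fun x => ?_, fun x => ?_⟩
  · simp
  · simp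

lemma comp_cosyzygyClass_bijective (X B : A) (k : ℕ) {m n : ℕ} (hm : 0 < m) (h : m + k = n) :
    Function.Bijective (fun x : Ext X (cosyzygy B k) m => x.comp (cosyzygyClass B k) h) := by
  induction k generalizing m n with
  | zero => exact comp_mk₀_iso_bijective X (cosyzygyZeroIso B).symm h
  | succ k ih =>
    have := (ih (m := m + 1) (n := n) (by omega) (by omega)).comp
      (comp_extClass_bijective X B k hm rfl)
    convert this using 2 with x
    exact (Ext.comp_assoc _ _ _ _ _ (by omega)).symm

lemma mk₀_comp_cosyzygyClass_succ {X B : A} (k : ℕ) (w : X ⟶ cosyzygy B (k + 1)) :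
    (Ext.mk₀ w).comp (cosyzygyClass B (k + 1)) (zero_add _) =
      ((Ext.mk₀ w).comp (cosyzygySeq_shortExact B k).extClass (zero_add 1)).comp
        (cosyzygyClass B k) (add_comm 1 k) :=
  (Ext.comp_assoc _ _ _ _ _ (by omega)).symm

/-- Dimension shifting is bijective down to `Ext¹(X, Σᵏ B)`; the last step to `Hom(X, Σᵏ⁺¹ B)` is
still surjective because `Ext¹(X, Iᵏ) = 0`. -/
lemma exists_mk₀_comp_cosyzygyClass {X B : A} (k : ℕ) (y : Ext X B (k + 1)) :
    ∃ w : X ⟶ cosyzygy B (k + 1),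
      (Ext.mk₀ w).comp (cosyzygyClass B (k + 1)) (zero_add _) = y := by
  obtain ⟨z, rfl⟩ := (comp_cosyzygyClass_bijective X B k one_pos (add_comm 1 k)).2 y
  obtain ⟨w, rfl⟩ := Ext.covariant_sequence_exact₁ X (cosyzygySeq_shortExact B k) z
    (Ext.eq_zero_of_injective _) (zero_add 1)
  obtain ⟨w, rfl⟩ := (Ext.mk₀_bijective _ _).2 w
  exact ⟨w, mk₀_comp_cosyzygyClass_succ k w⟩

/-- The kernel arises only at the step from degree 0 to degree 1, where it consists of the maps that
lift to `Iᵏ`. -/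
lemma mk₀_comp_cosyzygyClass_eq_zero_iff {X B : A} (k : ℕ) (w : X ⟶ cosyzygy B (k + 1)) :
    (Ext.mk₀ w).comp (cosyzygyClass B (k + 1)) (zero_add _) = 0 ↔
      ∃ u : X ⟶ (res B).X k, u ≫ (res B).toCycles k (k + 1) = w := by
  rw [mk₀_comp_cosyzygyClass_succ]
  constructor
  · intro hw
    have h := (comp_cosyzygyClass_bijective X B k one_pos (add_comm 1 k)).1
      (hw.trans (Ext.zero_comp _ _ _ _ _).symm)
    obtain ⟨u, hu⟩ := Ext.covariant_sequence_exact₃ X (cosyzygySeq_shortExact B k) _ _ h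
    obtain ⟨u, rfl⟩ := (Ext.mk₀_bijective _ _).2 u
    rw [Ext.mk₀_comp_mk₀] at hu
    exact ⟨u, (Ext.mk₀_bijective _ _).1 hu⟩
  · rintro ⟨u, rfl⟩
    rw [← Ext.mk₀_comp_mk₀, Ext.comp_assoc_of_second_deg_zero]
    have : (Ext.mk₀ ((res B).toCycles k (k + 1))).comp
        (cosyzygySeq_shortExact B k).extClass (zero_add 1) = 0 :=
      (cosyzygySeq_shortExact B k).comp_extClass
    rw [this, Ext.comp_zero, Ext.zero_comp]

end CosyzygyClass

/-! ### Functors presented by a morphism, and their sub-stabilization -/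

section Presentations

variable {A : Type u} [Category.{v} A] [Abelian A]

/-- A presentation of a functor `F` as the cokernel of `Hom(P, -) ⟶ Hom(D, -)`, precomposition with
a morphism `δ : D ⟶ P`. -/
structure Presentation (F : A ⥤ AddCommGrpCat.{w}) {D P : A} (δ : D ⟶ P) where
  cls (M : A) : (D ⟶ M) →+ F.obj M
  map_cls {M N : A} (g : M ⟶ N) (x : D ⟶ M) : F.map g (cls M x) = cls N (x ≫ g)
  cls_surjective (M : A) : Function.Surjective (cls M)
  cls_eq_zero_iff {M : A} (x : D ⟶ M) : cls M x = 0 ↔ ∃ y : P ⟶ M, δ ≫ y = x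

/-- A natural transformation all of whose components are bijective, as a natural isomorphism. -/
def natIsoOfBijective {F G : A ⥤ AddCommGrpCat.{w}} (α : F ⟶ G)
    (h : ∀ B, Function.Bijective (α.app B)) : F ≅ G :=
  haveI (B : A) : IsIso (α.app B) := (ConcreteCategory.isIso_iff_bijective _).2 (h B)
  NatIso.ofComponents (fun B => asIso (α.app B)) (fun f => α.naturality f)

namespace Presentation

variable {F : A ⥤ AddCommGrpCat.{w}} {D P : A} {δ : D ⟶ P} (Q : Presentation F δ)

/-- The homomorphism from the value of a presented functor induced by a homomorphism from
`Hom(D, M)`. -/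
def lift {M : A} {G : AddCommGrpCat.{w}} (t : (D ⟶ M) →+ G) (ht : ∀ y, t (δ ≫ y) = 0) :
    F.obj M ⟶ G :=
  AddCommGrpCat.ofHom ((Q.cls M).liftOfSurjective (Q.cls_surjective M) ⟨t, fun x hx => by
    obtain ⟨y, rfl⟩ := (Q.cls_eq_zero_iff x).1 hx
    exact ht y⟩)

lemma lift_cls {M : A} {G : AddCommGrpCat.{w}} (t : (D ⟶ M) →+ G) (ht : ∀ y, t (δ ≫ y) = 0)
    (x : D ⟶ M) : Q.lift t ht (Q.cls M x) = t x :=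
  AddMonoidHom.liftOfRightInverse_comp_apply _ _ _ _ _

/-- The natural transformation from a presented functor induced by a natural family of homomorphisms
from `Hom(D, M)`. -/
def desc {G : A ⥤ AddCommGrpCat.{w}} (t : ∀ M, (D ⟶ M) →+ G.obj M)
    (ht : ∀ M y, t M (δ ≫ y) = 0)
    (nat : ∀ {M N : A} (g : M ⟶ N) (x : D ⟶ M), G.map g (t M x) = t N (x ≫ g)) : F ⟶ G where
  app M := Q.lift (t M) (ht M)
  naturality M N g := by
    ext y
    obtain ⟨x, rfl⟩ := Q.cls_surjective M y
    change Q.lift (t N) (ht N) (F.map g (Q.cls M x)) = G.map g (Q.lift (t M) (ht M) (Q.cls M x))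
    rw [Q.map_cls, lift_cls, lift_cls, nat]

lemma desc_cls {G : A ⥤ AddCommGrpCat.{w}} (t : ∀ M, (D ⟶ M) →+ G.obj M)
    (ht : ∀ M y, t M (δ ≫ y) = 0)
    (nat : ∀ {M N : A} (g : M ⟶ N) (x : D ⟶ M), G.map g (t M x) = t N (x ≫ g))
    {M : A} (x : D ⟶ M) : (Q.desc t ht nat).app M (Q.cls M x) = t M x :=
  Q.lift_cls (t M) (ht M) x

/-- Two functors presented by the same morphism are isomorphic. -/
def iso {G : A ⥤ AddCommGrpCat.{w}} (Q' : Presentation G δ) : F ≅ G :=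
  natIsoOfBijective
    (Q.desc Q'.cls (fun _ y => (Q'.cls_eq_zero_iff _).2 ⟨y, rfl⟩) (fun g x => Q'.map_cls g x)) (by
      intro M
      constructor
      · refine (injective_iff_map_eq_zero _).2 fun y hy => ?_
        obtain ⟨x, rfl⟩ := Q.cls_surjective M y
        rw [desc_cls] at hy
        exact (Q.cls_eq_zero_iff x).2 ((Q'.cls_eq_zero_iff x).1 hy)
      · intro y
        obtain ⟨x, rfl⟩ := Q'.cls_surjective M y
        exact ⟨Q.cls M x, Q.desc_cls _ _ _ x⟩)

include Q in
-- If `x ≫ S.g` factors through `δ`, projectivity lifts the second factor along `S.g`. Subtracting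
-- the resulting multiple of `δ` from `x` keeps its class and makes it factor through `S.f`.
lemma isHalfExact [Projective P] : IsHalfExact F := by
  intro S hS y
  have := hS.mono_f
  have := hS.epi_g
  obtain ⟨x, rfl⟩ := Q.cls_surjective _ y
  rw [Q.map_cls, Q.cls_eq_zero_iff]
  constructor
  · rintro ⟨z, hz⟩
    have e : (x - δ ≫ Projective.factorThru z S.g) ≫ S.g = 0 := by simp [hz]
    refine ⟨Q.cls _ (hS.exact.lift _ e), ?_⟩
    rw [Q.map_cls, hS.exact.lift_f, map_sub, (Q.cls_eq_zero_iff (δ ≫ _)).2 ⟨_, rfl⟩, sub_zero]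
  · rintro ⟨z, hz⟩
    obtain ⟨z, rfl⟩ := Q.cls_surjective _ z
    rw [Q.map_cls, ← sub_eq_zero, ← map_sub, Q.cls_eq_zero_iff] at hz
    obtain ⟨u, hu⟩ := hz
    -- Here `δ ≫ u = z ≫ S.f - x`, and composing with `S.g` kills the first term.
    refine ⟨(-u) ≫ S.g, ?_⟩
    rw [← Category.assoc, Preadditive.comp_neg, hu]
    simp

/-- The presentation of `Hom(H, -)`. -/
def hom (H : A) {P : A} : Presentation (preadditiveCoyoneda.obj (op H)) (0 : H ⟶ P) where
  cls M := AddMonoidHom.id _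
  map_cls _ _ := rfl
  cls_surjective _ x := ⟨x, rfl⟩
  cls_eq_zero_iff x := by
    constructor
    · rintro rfl
      exact ⟨0, zero_comp⟩
    · rintro ⟨y, rfl⟩
      exact zero_comp

/-- The presentation of `Ext¹(E, -)` given by a short exact sequence `0 ⟶ K ⟶ P ⟶ E ⟶ 0` with `P`
projective. -/
def ext₁ [HasExt.{v} A] {S : ShortComplex A} (hS : S.ShortExact) [Projective S.X₂] :
    Presentation (extFunctorObj S.X₃ 1) S.f where
  cls M := (hS.extClass.precomp M (add_zero 1)).comp Ext.addEquiv₀.symm.toAddMonoidHom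
  map_cls g x := by
    change (hS.extClass.comp (Ext.mk₀ x) (add_zero 1)).comp (Ext.mk₀ g) (add_zero 1) =
      hS.extClass.comp (Ext.mk₀ (x ≫ g)) (add_zero 1)
    rw [← Ext.mk₀_comp_mk₀]
    exact Ext.comp_assoc_of_third_deg_zero _ _ _ _
  cls_surjective M y := by
    obtain ⟨x, rfl⟩ := Ext.contravariant_sequence_exact₃ hS M y (Ext.eq_zero_of_projective _)
      (add_zero 1)
    obtain ⟨x, rfl⟩ := (Ext.mk₀_bijective _ _).2 x
    exact ⟨x, rfl⟩
  cls_eq_zero_iff {M} x := by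
    constructor
    · intro hx
      obtain ⟨y, hy⟩ := Ext.contravariant_sequence_exact₁ hS M (Ext.mk₀ x) (add_zero 1) hx
      obtain ⟨y, rfl⟩ := (Ext.mk₀_bijective _ _).2 y
      rw [Ext.mk₀_comp_mk₀] at hy
      exact ⟨y, (Ext.mk₀_bijective _ _).1 hy⟩
    · rintro ⟨y, rfl⟩
      change hS.extClass.comp (Ext.mk₀ (S.f ≫ y)) (add_zero 1) = 0
      rw [← Ext.mk₀_comp_mk₀, hS.extClass_comp_assoc]

section SubStab

variable [EnoughInjectives A] [F.Additive]

include Q in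
-- Followed by an embedding of `M` in an injective object, `x` extends along `i` to `P`, so the
-- class becomes zero there.
lemma exists_subStabι_eq {K : A} (e : D ⟶ K) (i : K ⟶ P) [Mono i] (h : e ≫ i = δ)
    {M : A} (x : K ⟶ M) : ∃ y, (subStabι F).app M y = Q.cls M (e ≫ x) := by
  refine exists_subStab F (Injective.ι M) _ ((Q.map_cls _ _).trans ?_)
  refine (Q.cls_eq_zero_iff _).2 ⟨Injective.factorThru (x ≫ Injective.ι M) i, ?_⟩
  rw [← h, Category.assoc, Injective.comp_factorThru, Category.assoc]

/-- The homomorphism from `Hom(K, M)` to the sub-stabilization of `F` at `M`, where `K` is the image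
of `δ`. -/
def subStabCls {K : A} (e : D ⟶ K) (i : K ⟶ P) [Mono i] (h : e ≫ i = δ) (M : A) :
    (K ⟶ M) →+ (subStab F).obj M where
  toFun x := (Q.exists_subStabι_eq e i h x).choose
  map_zero' := subStabι_injective F M (by
    rw [(Q.exists_subStabι_eq e i h (0 : K ⟶ M)).choose_spec, comp_zero, map_zero, map_zero])
  map_add' x y := subStabι_injective F M (by
    rw [map_add, (Q.exists_subStabι_eq e i h (x + y)).choose_spec,
      (Q.exists_subStabι_eq e i h x).choose_spec, (Q.exists_subStabι_eq e i h y).choose_spec,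
      Preadditive.comp_add, map_add])

lemma subStabι_subStabCls {K : A} (e : D ⟶ K) (i : K ⟶ P) [Mono i] (h : e ≫ i = δ) {M : A}
    (x : K ⟶ M) : (subStabι F).app M (Q.subStabCls e i h M x) = Q.cls M (e ≫ x) :=
  (Q.exists_subStabι_eq e i h x).choose_spec

/-- The presentation of the sub-stabilization of `F` by the image of `δ`. -/
def subStab {K : A} (e : D ⟶ K) [Epi e] (i : K ⟶ P) [Mono i] (h : e ≫ i = δ) :
    Presentation (subStab F) i where
  cls := Q.subStabCls e i h
  map_cls {M N} g x := by
    apply subStabι_injective F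
    have nat := ConcreteCategory.congr_hom ((subStabι F).naturality g) (Q.subStabCls e i h M x)
    refine nat.trans ?_
    rw [subStabι_subStabCls, ← Category.assoc, ← Q.map_cls, ← Q.subStabι_subStabCls e i h]
    rfl
  cls_surjective M y := by
    obtain ⟨x, hx⟩ := Q.cls_surjective M ((subStabι F).app M y)
    have h₁ : Q.cls _ (x ≫ Injective.ι M) = 0 := by
      rw [← Q.map_cls, hx, map_subStabι]
    obtain ⟨u, hu⟩ := (Q.cls_eq_zero_iff _).1 h₁
    -- After embedding `M` in an injective object, `x` factors through `δ = e ≫ i`; hence `x` kills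
    -- the kernel of `e` and descends to `K`.
    have h₂ : kernel.ι e ≫ x = 0 := by
      rw [← cancel_mono (Injective.ι M), Category.assoc, ← hu, ← h, zero_comp]
      simp
    refine ⟨Abelian.epiDesc e x h₂, subStabι_injective F M ?_⟩
    rw [subStabι_subStabCls, Abelian.comp_epiDesc, hx]
  cls_eq_zero_iff {M} x := by
    rw [← (subStabι_injective F M).eq_iff, subStabι_subStabCls, map_zero, Q.cls_eq_zero_iff, ← h]
    simp only [Category.assoc, cancel_epi]

end SubStab

end Presentation

end Presentations

/-! ### Terms of the fundamental sequence of a presented functor as Ext functors -/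

section Terms

variable {A : Type u} [Category.{v} A] [Abelian A] [EnoughInjectives A]

namespace Presentation

section Ext

variable [HasExt.{v} A] {F : A ⥤ AddCommGrpCat.{v}} [F.Additive] {D P : A} {δ : D ⟶ P}
  (Q : Presentation F δ) [Projective P]

/-- The homomorphism `F(Σᵏ⁺¹ B) ⟶ Extᵏ⁺¹(D, B)`. -/
def toExt (B : A) (k : ℕ) : F.obj (cosyzygy B (k + 1)) ⟶ (extFunctorObj D (k + 1)).obj B :=
  Q.lift (((cosyzygyClass B (k + 1)).postcomp D (zero_add _)).comp
    Ext.addEquiv₀.symm.toAddMonoidHom) (fun y => by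
      change (Ext.mk₀ (δ ≫ y)).comp (cosyzygyClass B (k + 1)) (zero_add _) = 0
      rw [← Ext.mk₀_comp_mk₀, Ext.comp_assoc_of_second_deg_zero,
        Ext.eq_zero_of_projective ((Ext.mk₀ y).comp _ _), Ext.comp_zero])

omit [F.Additive] in
lemma toExt_cls {B : A} {k : ℕ} (x : D ⟶ cosyzygy B (k + 1)) :
    Q.toExt B k (Q.cls _ x) = (Ext.mk₀ x).comp (cosyzygyClass B (k + 1)) (zero_add _) :=
  Q.lift_cls _ _ x

omit [F.Additive] in
-- The maps `D ⟶ Σᵏ⁺¹ B` with zero Ext class are those that lift to `Iᵏ`. Passing from maps to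
-- classes in `F` divides out only maps through `P`, and these lift to `Iᵏ` already, since `P` is
-- projective and `Iᵏ ⟶ Σᵏ⁺¹ B` is epi.
lemma toExt_eq_zero_iff {B : A} {k : ℕ} (y : F.obj (cosyzygy B (k + 1))) :
    Q.toExt B k y = 0 ↔ ∃ x, F.map ((res B).toCycles k (k + 1)) x = y := by
  obtain ⟨y, rfl⟩ := Q.cls_surjective _ y
  rw [toExt_cls]
  refine (mk₀_comp_cosyzygyClass_eq_zero_iff k y).trans ?_
  constructor
  · rintro ⟨u, rfl⟩
    exact ⟨Q.cls _ u, Q.map_cls _ _⟩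
  · rintro ⟨x, hx⟩
    obtain ⟨x, rfl⟩ := Q.cls_surjective _ x
    rw [Q.map_cls, eq_comm, ← sub_eq_zero, ← map_sub, Q.cls_eq_zero_iff] at hx
    obtain ⟨z, hz⟩ := hx
    have : Epi ((res B).toCycles k (k + 1)) := (cosyzygySeq_shortExact B k).epi_g
    refine ⟨x + δ ≫ Projective.factorThru z ((res B).toCycles k (k + 1)), ?_⟩
    simp [hz]

omit [F.Additive] in
lemma toExt_surjective (B : A) (k : ℕ) : Function.Surjective (Q.toExt B k) := by
  intro y
  obtain ⟨x, rfl⟩ := exists_mk₀_comp_cosyzygyClass k y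
  exact ⟨_, Q.toExt_cls x⟩

omit [F.Additive] in
lemma toExt_naturality {B B' : A} (f : B ⟶ B') (k : ℕ) :
    F.map (cosyzygyMap f (k + 1)) ≫ Q.toExt B' k =
      Q.toExt B k ≫ (extFunctorObj D (k + 1)).map f := by
  ext y
  obtain ⟨x, rfl⟩ := Q.cls_surjective _ y
  change Q.toExt B' k (F.map (cosyzygyMap f (k + 1)) (Q.cls _ x)) =
    (Q.toExt B k (Q.cls _ x) : Ext D B (k + 1)).comp (Ext.mk₀ f) (add_zero _)
  rw [Q.map_cls, toExt_cls, toExt_cls, ← Ext.mk₀_comp_mk₀, Ext.comp_assoc_of_third_deg_zero,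
    ← cosyzygyClass_naturality]
  exact Ext.comp_assoc_of_second_deg_zero _ _ _ _

/-- The homomorphism `Sᵏ⁺¹F(B) ⟶ Extᵏ⁺¹(D, B)`. -/
def satelliteObjToExt (B : A) (k : ℕ) : satelliteObj F B k ⟶ (extFunctorObj D (k + 1)).obj B :=
  cokernel.desc _ (Q.toExt B k) (by
    ext x
    exact (Q.toExt_eq_zero_iff _).2 ⟨x, rfl⟩)

/-- The natural transformation `Sᵏ⁺¹F ⟶ Extᵏ⁺¹(D, -)`. -/
def satelliteToExt (k : ℕ) : satellite F k ⟶ extFunctorObj D (k + 1) where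
  app B := Q.satelliteObjToExt B k
  naturality B B' f := by
    have : satelliteMap F f k ≫ Q.satelliteObjToExt B' k =
        Q.satelliteObjToExt B k ≫ (extFunctorObj D (k + 1)).map f := by
      rw [← cancel_epi (cokernel.π (F.map ((res B).toCycles k (k + 1))))]
      simp only [satelliteMap, satelliteObjToExt, cokernel.π_desc_assoc, Category.assoc,
        cokernel.π_desc, toExt_naturality]
    exact this

/-- The isomorphism `Sᵏ⁺¹F ≅ Extᵏ⁺¹(D, -)`. -/
def satelliteIso (k : ℕ) : satellite F k ≅ extFunctorObj D (k + 1) :=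
  natIsoOfBijective (Q.satelliteToExt k) (by
    intro B
    have h (y : F.obj (cosyzygy B (k + 1))) : (Q.satelliteToExt k).app B
        (cokernel.π (F.map ((res B).toCycles k (k + 1))) y) = Q.toExt B k y :=
      ConcreteCategory.congr_hom (cokernel.π_desc _ _ _) y
    constructor
    · refine (injective_iff_map_eq_zero _).2 fun y hy => ?_
      obtain ⟨y, rfl⟩ := cokernelπ_surjective _ y
      exact (cokernelπ_eq_zero_iff _ _).2 ((Q.toExt_eq_zero_iff y).1 ((h y).symm.trans hy))
    · intro y
      obtain ⟨x, rfl⟩ := Q.toExt_surjective B k y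
      exact ⟨_, h x⟩)

/-- The isomorphism `F̄ ≅ Ext¹(E, -)`, where `E` is the cokernel of `δ`. -/
def subStabIso {E : A} {p : P ⟶ E} [Epi p] (w : δ ≫ p = 0) (hp : (ShortComplex.mk δ p w).Exact) :
    FundSeq.subStab F ≅ extFunctorObj E 1 :=
  let e := Abelian.factorThruImage δ
  let i := Abelian.image.ι δ
  have hi : e ≫ i = δ := Abelian.image.fac δ
  have w' : i ≫ p = 0 := by rw [← cancel_epi e, ← Category.assoc, hi, w, comp_zero]
  let S : ShortComplex A := .mk i p w'
  have hS : S.ShortExact :=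
    { exact := by
        -- Replacing `δ` by the inclusion of its image does not affect exactness at `P`.
        have hSe : (ShortComplex.mk δ p w).Exact ↔ S.Exact :=
          ShortComplex.exact_iff_of_epi_of_isIso_of_mono
            (S₁ := .mk δ p w) (S₂ := S) { τ₁ := e, τ₂ := 𝟙 P, τ₃ := 𝟙 E }
        exact hSe.1 hp
      mono_f := inferInstanceAs (Mono i)
      epi_g := inferInstanceAs (Epi p) }
  haveI : Projective S.X₂ := inferInstanceAs (Projective P)
  (Q.subStab e i hi).iso (ext₁ hS)

end Ext

end Presentation

/-! ### Composing the sub-stabilization with cosyzygies -/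

section Shift

variable [HasExt.{v} A] {F : A ⥤ AddCommGrpCat.{v}} [F.Additive] {E : A}

lemma comp_cosyzygyClass_naturality {B B' : A} (f : B ⟶ B') {k m n : ℕ} (h : m + k = n)
    (x : Ext E (cosyzygy B k) m) :
    (x.comp (Ext.mk₀ (cosyzygyMap f k)) (add_zero m)).comp (cosyzygyClass B' k) h =
      (x.comp (cosyzygyClass B k) h).comp (Ext.mk₀ f) (add_zero n) := by
  rw [Ext.comp_assoc_of_second_deg_zero, cosyzygyClass_naturality,
    Ext.comp_assoc_of_third_deg_zero]

/-- An isomorphism `F̄ ≅ Ext¹(E, -)` induces isomorphisms `F̄ ∘ Σᵏ⁺¹ ≅ Extᵏ⁺²(E, -)`. -/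
def subStabCosyzygyIso (σ : subStab F ≅ extFunctorObj E 1) (k : ℕ) :
    subStabCosyzygy F k ≅ extFunctorObj E (k + 2) :=
  natIsoOfBijective
    { app := fun B => σ.hom.app (cosyzygy B (k + 1)) ≫
        AddCommGrpCat.ofHom ((cosyzygyClass B (k + 1)).postcomp E (add_comm 1 (k + 1)))
      naturality := fun B B' f => by
        ext x
        have h : σ.hom.app (cosyzygy B' (k + 1)) ((subStab F).map (cosyzygyMap f (k + 1)) x) =
            (σ.hom.app (cosyzygy B (k + 1)) x : Ext E (cosyzygy B (k + 1)) 1).comp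
              (Ext.mk₀ (cosyzygyMap f (k + 1))) (add_zero 1) :=
          ConcreteCategory.congr_hom (σ.hom.naturality (cosyzygyMap f (k + 1))) x
        change (σ.hom.app (cosyzygy B' (k + 1)) ((subStab F).map (cosyzygyMap f (k + 1)) x) :
            Ext E (cosyzygy B' (k + 1)) 1).comp (cosyzygyClass B' (k + 1)) (add_comm 1 (k + 1)) =
          ((σ.hom.app (cosyzygy B (k + 1)) x : Ext E (cosyzygy B (k + 1)) 1).comp
            (cosyzygyClass B (k + 1)) (add_comm 1 (k + 1))).comp (Ext.mk₀ f) (add_zero _)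
        rw [h]
        exact comp_cosyzygyClass_naturality f _ _ }
    (fun B => (comp_cosyzygyClass_bijective E B (k + 1) one_pos (add_comm 1 (k + 1))).comp
      ((ConcreteCategory.isIso_iff_bijective (σ.hom.app (cosyzygy B (k + 1)))).1 inferInstance))

end Shift

/-! ### Right derived functors, and those of `Hom(H, -)` -/

section RightDerived

open ZeroObject

variable {F G : A ⥤ AddCommGrpCat.{w}} [F.Additive] [G.Additive]

/-- A transformation that is bijective on injective objects induces isomorphisms of right derived
functors. -/
lemma isIso_rightDerived (α : F ⟶ G)
    (h : ∀ J : A, Injective J → Function.Bijective (α.app J)) (k : ℕ) :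
    IsIso (NatTrans.rightDerived α k) := by
  have (B : A) : IsIso ((NatTrans.rightDerived α k).app B) := by
    rw [(injectiveResolution B).rightDerived_app_eq]
    have (i : ℕ) : IsIso (((NatTrans.mapHomologicalComplex α (ComplexShape.up ℕ)).app
        (injectiveResolution B).cocomplex).f i) :=
      (ConcreteCategory.isIso_iff_bijective _).2 (h _ ((injectiveResolution B).injective i))
    have := HomologicalComplex.Hom.isIso_of_components
      ((NatTrans.mapHomologicalComplex α (ComplexShape.up ℕ)).app
        (injectiveResolution B).cocomplex)
    infer_instance
  exact NatIso.isIso_of_isIso_app _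

lemma toMapResHomology_naturality (α : F ⟶ G) (B : A) (i : ℕ) :
    toMapResHomology F B i ≫ HomologicalComplex.homologyMap
        ((NatTrans.mapHomologicalComplex α (ComplexShape.up ℕ)).app (res B)) i =
      α.app (cosyzygy B i) ≫ toMapResHomology G B i := by
  have h : toMapResCycles F B i ≫ HomologicalComplex.cyclesMap
        ((NatTrans.mapHomologicalComplex α (ComplexShape.up ℕ)).app (res B)) i =
      α.app (cosyzygy B i) ≫ toMapResCycles G B i := by
    rw [← cancel_mono ((mapRes G B).iCycles i), Category.assoc, Category.assoc,
      HomologicalComplex.cyclesMap_i, ← Category.assoc]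
    refine (congrArg (· ≫ _) ((mapRes F B).liftCycles_i _ _ _ _)).trans ?_
    refine Eq.trans ?_ (congrArg (α.app _ ≫ ·) ((mapRes G B).liftCycles_i _ _ _ _)).symm
    exact α.naturality _
  rw [toMapResHomology, toMapResHomology, Category.assoc, HomologicalComplex.homologyπ_naturality,
    ← Category.assoc, h, Category.assoc]

/-- Naturality of `ρ_F` in `F`; it serves to recognise `ρ` for `Hⁿ(C, -)` as the canonical map. -/
lemma toRightDerivedZero_comp_rightDerived (α : F ⟶ G) :
    F.toRightDerivedZero ≫ NatTrans.rightDerived α 0 = α ≫ G.toRightDerivedZero := by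
  ext B : 2
  let I := injectiveResolution B
  have h₁ : F.toRightDerivedZero.app B ≫ (I.isoRightDerivedObj F 0).hom ≫
      (HomologicalComplex.homologyFunctor AddCommGrpCat.{w} (ComplexShape.up ℕ) 0).map
        ((NatTrans.mapHomologicalComplex α (ComplexShape.up ℕ)).app I.cocomplex) =
      α.app B ≫ G.toRightDerivedZero.app B ≫ (I.isoRightDerivedObj G 0).hom := by
    refine (Category.assoc _ _ _).symm.trans ?_
    refine (congrArg (· ≫ _) (toRightDerivedZero_app_comp F B)).trans ?_
    refine Eq.trans ?_ (congrArg (α.app B ≫ ·) (toRightDerivedZero_app_comp G B)).symm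
    refine (Category.assoc _ _ _).trans ?_
    refine (congrArg (F.map _ ≫ ·) (toMapResHomology_naturality α B 0)).trans ?_
    exact α.naturality_assoc _ _
  rw [NatTrans.comp_app, NatTrans.comp_app, I.rightDerived_app_eq,
    ← cancel_mono (I.isoRightDerivedObj G 0).hom]
  simp only [Category.assoc, Iso.inv_hom_id, Category.comp_id]
  exact h₁

/-- For a left exact functor `ρ_F` is mono, so `F̄ = 0`, and the exact fundamental sequence breaks
up into isomorphisms `Sᵏ⁺¹F ≅ Rᵏ⁺¹F`. -/
lemma satelliteToRightDerived_bijective [PreservesFiniteLimits F] (k : ℕ) (B : A) :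
    Function.Bijective ((satelliteToRightDerived F k).app B) := by
  have hF : IsHalfExact F := fun S hS =>
    (ShortComplex.ab_exact_iff_function_exact _).1 (hS.exact.map_of_mono_of_preservesKernel F
      hS.mono_f inferInstance)
  have h (X : A) (x : (subStab F).obj X) : x = 0 := by
    apply subStabι_injective F X
    apply (AddCommGrpCat.mono_iff_injective (F.toRightDerivedZero.app X)).1 inferInstance
    rw [map_zero, map_zero]
    exact ConcreteCategory.congr_hom (subStabι_comp_app F X) x
  have H := rightFundamentalSeq_isExact F hF
  constructor
  · refine (injective_iff_map_eq_zero _).2 fun x hx => ?_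
    obtain ⟨y, rfl⟩ := (H.exact_Y (k + 1) B x).1 hx
    exact (congrArg _ (h _ y)).trans (map_zero _)
  · intro y
    exact (H.exact_Z (k + 1) B y).1 (h _ _)

/-- The isomorphism `Rᵏ⁺¹ Hom(H, -) ≅ Extᵏ⁺¹(H, -)`. -/
def rightDerivedHomIso [HasExt.{v} A] (H : A) (k : ℕ) :
    (preadditiveCoyoneda.obj (op H)).rightDerived (k + 1) ≅ extFunctorObj H (k + 1) :=
  (natIsoOfBijective _ (satelliteToRightDerived_bijective k)).symm ≪≫
    -- `Hom(H, -)` is presented by `H ⟶ 0`, so the computation of satellites applies with `D = H`.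
    haveI : Projective (0 : A) := inferInstance
    (Presentation.hom H (P := (0 : A))).satelliteIso k

end RightDerived

namespace Presentation

variable {F : A ⥤ AddCommGrpCat.{v}} {D P : A} {δ : D ⟶ P} (Q : Presentation F δ)
  {H : A} (j : H ⟶ D) (w : j ≫ δ = 0)

/-- The transformation `F ⟶ Hom(H, -)`, where `H` is the kernel of `δ`. -/
def toHom : F ⟶ preadditiveCoyoneda.obj (op H) :=
  Q.desc (G := preadditiveCoyoneda.obj (op H)) (fun M => Preadditive.leftComp M j) (fun M y => by
    change j ≫ δ ≫ y = 0
    rw [← Category.assoc, w, zero_comp]) (fun g x => Category.assoc _ _ _)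

omit [EnoughInjectives A] in
lemma toHom_cls {M : A} (x : D ⟶ M) : (Q.toHom j w).app M (Q.cls M x) = j ≫ x :=
  Q.desc_cls (G := preadditiveCoyoneda.obj (op H)) _ _ (fun _ _ => Category.assoc _ _ _) x

omit [EnoughInjectives A] in
-- For injective `J`, a map `D ⟶ J` that vanishes on the kernel `H` of `δ` extends over `P`, so its
-- class is zero; and every `H ⟶ J` extends along `j`.
lemma toHom_bijective [Mono j] (hj : (ShortComplex.mk j δ w).Exact) (J : A) [Injective J] :
    Function.Bijective ((Q.toHom j w).app J) := by
  constructor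
  · refine (injective_iff_map_eq_zero _).2 fun y hy => ?_
    obtain ⟨x, rfl⟩ := Q.cls_surjective J y
    rw [toHom_cls] at hy
    exact (Q.cls_eq_zero_iff x).2 ⟨hj.descToInjective x hy, hj.comp_descToInjective x hy⟩
  · intro (y : H ⟶ J)
    exact ⟨Q.cls J (Injective.factorThru y j),
      (Q.toHom_cls j w _).trans (Injective.comp_factorThru y j)⟩

end Presentation

end Terms

/-! ### Transport of exactness along isomorphisms of sequences -/

section Transport

variable {A : Type u} [Category.{v} A]

lemma exact_of_iso {X Y Z X' Y' Z' : AddCommGrpCat.{w}} {f : X ⟶ Y} {g : Y ⟶ Z} {f' : X' ⟶ Y'}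
    {g' : Y' ⟶ Z'} (a : X ≅ X') (b : Y ≅ Y') (c : Z ≅ Z') (hf : f ≫ b.hom = a.hom ≫ f')
    (hg : g ≫ c.hom = b.hom ≫ g') (h : Function.Exact f g) : Function.Exact f' g' := by
  intro y
  obtain ⟨y, rfl⟩ := iso_hom_surjective b y
  have e₁ : g' (b.hom y) = c.hom (g y) := (ConcreteCategory.congr_hom hg y).symm
  have e₂ (x : X) : f' (a.hom x) = b.hom (f x) := (ConcreteCategory.congr_hom hf x).symm
  rw [e₁, map_eq_zero_iff _ (iso_hom_injective c), h y]
  constructor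
  · rintro ⟨x, rfl⟩
    exact ⟨a.hom x, e₂ x⟩
  · rintro ⟨x, hx⟩
    obtain ⟨x, rfl⟩ := iso_hom_surjective a x
    exact ⟨x, iso_hom_injective b ((e₂ x).symm.trans hx)⟩

lemma comp_app_eq {F G F' G' : A ⥤ AddCommGrpCat.{w}} {α : F ⟶ G} {α' : F' ⟶ G'} {a : F ≅ F'}
    {b : G ≅ G'} (h : α ≫ b.hom = a.hom ≫ α') (B : A) :
    α.app B ≫ (b.app B).hom = (a.app B).hom ≫ α'.app B :=
  congrArg (fun t => NatTrans.app t B) h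

lemma LongSeq.Iso.isExact {S T : LongSeq.{w} A} (φ : LongSeq.Iso S T) (h : S.IsExact) :
    T.IsExact where
  injective B := by
    refine (injective_iff_map_eq_zero _).2 fun x hx => ?_
    obtain ⟨x, rfl⟩ := iso_hom_surjective ((φ.isoX 0).app B) x
    have e : (T.f 0).app B (((φ.isoX 0).app B).hom x) =
        ((φ.isoY 0).app B).hom ((S.f 0).app B x) :=
      (ConcreteCategory.congr_hom (comp_app_eq (φ.comm_f 0) B) x).symm
    rw [e, map_eq_zero_iff _ (iso_hom_injective _), map_eq_zero_iff _ (h.injective B)] at hx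
    rw [hx, map_zero]
  exact_Y i B := exact_of_iso _ _ _ (comp_app_eq (φ.comm_f i) B) (comp_app_eq (φ.comm_g i) B)
    (h.exact_Y i B)
  exact_Z i B := exact_of_iso _ _ _ (comp_app_eq (φ.comm_g i) B) (comp_app_eq (φ.comm_h i) B)
    (h.exact_Z i B)
  exact_X i B := exact_of_iso _ _ _ (comp_app_eq (φ.comm_h i) B) (comp_app_eq (φ.comm_f (i + 1)) B)
    (h.exact_X i B)

end Transport

/-! ### The presentation of `Hⁿ(C, -)` by `Cₙ/Bₙ ⟶ Cₙ₋₁` -/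

section Cohomology

variable {A : Type u} [Category.{v} A] [Abelian A] (C : ChainComplex A ℤ) (n : ℤ)

/-- The homomorphism from `Hom(Cₙ/Bₙ, M)` to the `n`-cocycles with values in `M`. -/
def opcyclesToCocycles (M : A) :
    AddCommGrpCat.of (C.opcycles n ⟶ M) ⟶ ((homComplex C).obj M).cycles n :=
  ((homComplex C).obj M).liftCycles
    (AddCommGrpCat.ofHom (Preadditive.leftComp M (C.pOpcycles n))) (n + 1) (by simp) (by
      ext x
      change C.d (n + 1) n ≫ C.pOpcycles n ≫ x = 0
      simp)

lemma iCycles_opcyclesToCocycles {M : A} (x : C.opcycles n ⟶ M) :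
    ((homComplex C).obj M).iCycles n (opcyclesToCocycles C n M x) = C.pOpcycles n ≫ x := by
  have h : opcyclesToCocycles C n M ≫ ((homComplex C).obj M).iCycles n =
      AddCommGrpCat.ofHom (Preadditive.leftComp M (C.pOpcycles n)) :=
    ((homComplex C).obj M).liftCycles_i _ _ _ _
  exact ConcreteCategory.congr_hom h x

lemma opcyclesToCocycles_surjective (M : A) : Function.Surjective (opcyclesToCocycles C n M) := by
  intro z
  let z₀ : C.X n ⟶ M := ((homComplex C).obj M).iCycles n z
  have h : C.d (n + 1) n ≫ z₀ = 0 :=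
    ConcreteCategory.congr_hom (((homComplex C).obj M).iCycles_d n (n + 1)) z
  refine ⟨C.descOpcycles z₀ (n + 1) (by simp) h, iCycles_injective _ _ ?_⟩
  refine (iCycles_opcyclesToCocycles C n _).trans ?_
  exact C.p_descOpcycles _ _ _ _

lemma cyclesMap_opcyclesToCocycles {M N : A} (g : M ⟶ N) (x : C.opcycles n ⟶ M) :
    HomologicalComplex.cyclesMap ((homComplex C).map g) n (opcyclesToCocycles C n M x) =
      opcyclesToCocycles C n N (x ≫ g) := by
  apply iCycles_injective
  refine (ConcreteCategory.congr_hom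
    (HomologicalComplex.cyclesMap_i ((homComplex C).map g) n) _).trans ?_
  refine Eq.trans ?_ (iCycles_opcyclesToCocycles C n (x ≫ g)).symm
  refine (congrArg (((homComplex C).map g).f n) (iCycles_opcyclesToCocycles C n x)).trans ?_
  exact Category.assoc _ _ _

/-- The presentation of `Hⁿ(C, -)` by the morphism `Cₙ/Bₙ ⟶ Cₙ₋₁`. -/
def cohomologyPresentation : Presentation (cohomology C n) (C.fromOpcycles n (n - 1)) where
  cls M := (opcyclesToCocycles C n M ≫ ((homComplex C).obj M).homologyπ n).hom
  map_cls {M N} g x := by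
    refine (ConcreteCategory.congr_hom (HomologicalComplex.homologyπ_naturality
      ((homComplex C).map g) n) (opcyclesToCocycles C n M x)).trans ?_
    exact congrArg (((homComplex C).obj N).homologyπ n) (cyclesMap_opcyclesToCocycles C n g x)
  cls_surjective M y := by
    obtain ⟨z, rfl⟩ := homologyπ_surjective _ _ y
    obtain ⟨x, rfl⟩ := opcyclesToCocycles_surjective C n M z
    exact ⟨x, rfl⟩
  cls_eq_zero_iff {M} x := by
    -- Viewed in `Hom(Cₙ, M)`, both equations say that `y` precomposed with the differential is `x`
    -- precomposed with the epimorphism `Cₙ ⟶ Cₙ/Bₙ`.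
    have key (y : C.X (n - 1) ⟶ M) :
        ((homComplex C).obj M).toCycles (n - 1) n y = opcyclesToCocycles C n M x ↔
          C.fromOpcycles n (n - 1) ≫ y = x := by
      rw [← (iCycles_injective ((homComplex C).obj M) n).eq_iff, iCycles_opcyclesToCocycles,
        ← cancel_epi (C.pOpcycles n), ← Category.assoc, C.p_fromOpcycles]
      exact iff_of_eq (congrArg (· = _)
        (ConcreteCategory.congr_hom (((homComplex C).obj M).toCycles_i (n - 1) n) y))
    constructor
    · intro hx
      obtain ⟨y, hy⟩ := exists_boundary ((homComplex C).obj M) (i := n - 1) (by simp) _ hx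
      exact ⟨y, (key y).1 hy⟩
    · rintro ⟨y, hy⟩
      refine (congrArg (((homComplex C).obj M).homologyπ n) ((key y).2 hy).symm).trans ?_
      exact ConcreteCategory.congr_hom
        (((homComplex C).obj M).toCycles_comp_homologyπ (n - 1) n) y

lemma fromOpcycles_comp_pOpcycles :
    C.fromOpcycles n (n - 1) ≫ C.pOpcycles (n - 1) = 0 := by
  rw [← cancel_epi (C.pOpcycles n)]
  simp

/-- `Cₙ₋₁/Bₙ₋₁` is the cokernel of the differential, which has the same image as `δ` because `Cₙ ⟶
Cₙ/Bₙ` is epi. -/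
lemma exact_fromOpcycles_pOpcycles :
    (ShortComplex.mk _ _ (fromOpcycles_comp_pOpcycles C n)).Exact := by
  have h := ShortComplex.exact_of_g_is_cokernel (.mk _ _ (C.d_pOpcycles n (n - 1)))
    (C.opcyclesIsCokernel n (n - 1) (by simp))
  exact (ShortComplex.exact_iff_of_epi_of_isIso_of_mono (S₁ := .mk _ _ (C.d_pOpcycles n (n - 1)))
    (S₂ := .mk _ _ (fromOpcycles_comp_pOpcycles C n))
    { τ₁ := C.pOpcycles n, τ₂ := 𝟙 _, τ₃ := 𝟙 _ }).1 h

lemma exact_homologyι_fromOpcycles :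
    (ShortComplex.mk _ _ (C.homologyι_comp_fromOpcycles n (n - 1))).Exact :=
  ShortComplex.exact_of_f_is_kernel _ (C.homologyIsKernel n (n - 1) (by simp))

/-- The canonical transformation `Hⁿ(C, -) ⟶ (Hₙ(C), -)`. -/
def cohomologyToHom : cohomology C n ⟶ preadditiveCoyoneda.obj (op (C.homology n)) :=
  (cohomologyPresentation C n).toHom (C.homologyι n) (C.homologyι_comp_fromOpcycles n (n - 1))

lemma cohomologyToHom_isCanonical : IsCanonical C n (cohomologyToHom C n) := by
  rintro M z z₀ r hz rfl
  obtain ⟨x, rfl⟩ := opcyclesToCocycles_surjective C n M z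
  rw [iCycles_opcyclesToCocycles] at hz
  subst hz
  have h : (cohomologyToHom C n).app M
      (((homComplex C).obj M).homologyπ n (opcyclesToCocycles C n M x)) = C.homologyι n ≫ x :=
    (cohomologyPresentation C n).toHom_cls _ _ x
  refine (congrArg (C.homologyπ n ≫ ·) h).trans ?_
  simp

variable [EnoughInjectives A]

/-- The isomorphisms `Rⁱ Hⁿ(C, -) ≅ Extⁱ(Hₙ(C), -)`. -/
def rightDerivedCohomologyIso [HasExt.{v} A] : ∀ i : ℕ, (cohomology C n).rightDerived i ≅ ucZ C n i
  | 0 =>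
    haveI := isIso_rightDerived (cohomologyToHom C n)
      (fun J _ => Presentation.toHom_bijective _ _ _ (exact_homologyι_fromOpcycles C n) J) 0
    asIso (NatTrans.rightDerived (cohomologyToHom C n) 0) ≪≫ Functor.rightDerivedZeroIsoSelf _
  | k + 1 =>
    haveI := isIso_rightDerived (cohomologyToHom C n)
      (fun J _ => Presentation.toHom_bijective _ _ _ (exact_homologyι_fromOpcycles C n) J) (k + 1)
    asIso (NatTrans.rightDerived (cohomologyToHom C n) (k + 1)) ≪≫
      rightDerivedHomIso (C.homology n) k

lemma toRightDerivedZero_comp_iso [HasExt.{v} A] :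
    (cohomology C n).toRightDerivedZero ≫ (rightDerivedCohomologyIso C n 0).hom =
      cohomologyToHom C n := by
  let G := preadditiveCoyoneda.obj (op (C.homology n))
  have h : (cohomology C n).toRightDerivedZero ≫ NatTrans.rightDerived (cohomologyToHom C n) 0 ≫
      G.rightDerivedZeroIsoSelf.hom = cohomologyToHom C n := by
    rw [← Category.assoc, toRightDerivedZero_comp_rightDerived, Category.assoc,
      G.rightDerivedZeroIsoSelf_inv_hom_id, Category.comp_id]
  exact h

variable [HasExt.{v} A] [Projective (C.X (n - 1))]

/-- The isomorphisms `F̄ ∘ Σⁱ ≅ Extⁱ⁺¹(Cₙ₋₁/Bₙ₋₁, -)` for `F = Hⁿ(C, -)`. -/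
def subStabCohomologyIso :
    ∀ i : ℕ, (rightFundamentalSeq (cohomology C n)).X i ≅ ucX C n i
  | 0 => (cohomologyPresentation C n).subStabIso _ (exact_fromOpcycles_pOpcycles C n)
  | k + 1 => subStabCosyzygyIso
      ((cohomologyPresentation C n).subStabIso _ (exact_fromOpcycles_pOpcycles C n)) k

/-- The isomorphisms `Sⁱ Hⁿ(C, -) ≅ Extⁱ(Cₙ/Bₙ, -)`, and the identity of `Hⁿ(C, -)`. -/
def satelliteCohomologyIso :
    ∀ i : ℕ, (rightFundamentalSeq (cohomology C n)).Y i ≅ ucY C n i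
  | 0 => Iso.refl _
  | k + 1 => (cohomologyPresentation C n).satelliteIso k

end Cohomology

end FundSeq

end
theorem mainTheorem6 {A : Type u} [Category.{v} A] [Abelian A] [EnoughInjectives A]
    (C : ChainComplex A ℤ) (hC : ∀ i : ℤ, Projective (C.X i)) (n : ℤ) :
    (FundSeq.rightFundamentalSeq (FundSeq.cohomology C n)).IsExact ∧
    ∃ (f : ∀ i : ℕ, FundSeq.ucX C n i ⟶ FundSeq.ucY C n i)
      (g : ∀ i : ℕ, FundSeq.ucY C n i ⟶ FundSeq.ucZ C n i)
      (h : ∀ i : ℕ, FundSeq.ucZ C n i ⟶ FundSeq.ucX C n (i + 1))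
      (φ : FundSeq.LongSeq.Iso (FundSeq.rightFundamentalSeq (FundSeq.cohomology C n))
        ⟨FundSeq.ucX C n, FundSeq.ucY C n, FundSeq.ucZ C n, f, g, h⟩),
      FundSeq.LongSeq.IsExact
        ⟨FundSeq.ucX C n, FundSeq.ucY C n, FundSeq.ucZ C n, f, g, h⟩ ∧
      φ.isoY 0 = Iso.refl (FundSeq.cohomology C n) ∧
      FundSeq.IsCanonical C n (g 0) := by
  -- `HasExt` is a proposition, so the functors formed with this instance agree definitionally with
  -- `FundSeq.ext`.
  have : HasExt.{v} A := hasExt_of_enoughInjectives.{v} A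
  have := hC (n - 1)
  let S := FundSeq.rightFundamentalSeq (FundSeq.cohomology C n)
  let a := FundSeq.subStabCohomologyIso C n
  let b := FundSeq.satelliteCohomologyIso C n
  let c := FundSeq.rightDerivedCohomologyIso C n
  have hS : S.IsExact := FundSeq.rightFundamentalSeq_isExact _
    (FundSeq.cohomologyPresentation C n).isHalfExact
  -- The maps of the target are conjugates of those of `S`, so the squares commute by construction.
  let φ : FundSeq.LongSeq.Iso S
      ⟨FundSeq.ucX C n, FundSeq.ucY C n, FundSeq.ucZ C n,
        fun i => (a i).inv ≫ S.f i ≫ (b i).hom,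
        fun i => (b i).inv ≫ S.g i ≫ (c i).hom,
        fun i => (c i).inv ≫ S.h i ≫ (a (i + 1)).hom⟩ :=
    { isoX := a
      isoY := b
      isoZ := c
      comm_f := fun i => ((a i).hom_inv_id_assoc _).symm
      comm_g := fun i => ((b i).hom_inv_id_assoc _).symm
      comm_h := fun i => ((c i).hom_inv_id_assoc _).symm }
  refine ⟨hS, _, _, _, φ, φ.isExact hS, rfl, ?_⟩
  -- As `b 0` is the identity, this map is `ρ` followed by `R⁰F ≅ (Hₙ(C), -)`.
  have h : (b 0).inv ≫ S.g 0 ≫ (c 0).hom = FundSeq.cohomologyToHom C n :=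
    (Category.id_comp _).trans (FundSeq.toRightDerivedZero_comp_iso C n)
  exact Eq.subst (motive := FundSeq.IsCanonical C n) h.symm
    (FundSeq.cohomologyToHom_isCanonical C n)
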